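/- **Model.** Let $\lambda,h,P,\gamma,A^{\mathrm L},A^{\mathrm{NL}},\alpha^{\mathrm L},\alpha^{\mathrm{NL}}>0$, $N_0\ge 0$, and let $\Pr^{\mathrm L}:[h,\infty)\to[0,1]$ be measurable. UAV base stations form a homogeneous Poisson point process of density $\lambda$ in the plane $\{(x_1,x_2,h)\}$ at height $h$; fix a user at a point of the ground plane (height $0$), and let $r_i$ be the 3D distance from the user to the $i$-th UAV. Given the positions, the links are independently line-of-sight (LoS) with probability $\Pr^{\mathrm L}(r_i)$ and otherwise non-line-of-sight (NLoS). A LoS link of length $r$ has path loss $\zeta^{\mathrm L}(r)=A^{\mathrm L}r^{-\alpha^{\mathrm L}}$, an NLoS link $\zeta^{\mathrm{NL}}(r)=A^{\mathrm{NL}}r^{-\alpha^{\mathrm{NL}}}$; let $\beta_i$ be the path loss of link $i$. The channel gains $g_i$ (Rayleigh fading) are i.i.d. exponential with mean one, independent of positions and link types. The user is served by the UAV $b_o$ with the strongest mean signal $P\beta_i$. The interference is $I=\sum_{i\ne o}P\beta_i g_i\in[0,\infty]$, the SINR is $P\beta_o g_o/(I+N_0)$, and the coverage probability of this network of randomly hovering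 UAVs (called the lower bound of the coverage probability, because the mobility of the UAVs is not exploited) is $p^{\mathrm{cov}}_{\mathrm{lower}}(\lambda,\gamma)=\Pr(\mathrm{SINR}>\gamma)$. For $r\ge h$ let $r_1,r_2>0$ be the solutions of $\zeta^{\mathrm{NL}}(r_1)=\zeta^{\mathrm L}(r)$ and $\zeta^{\mathrm L}(r_2)=\zeta^{\mathrm{NL}}(r)$, and put $$f^{\mathrm L}(r)=\exp\Big(-\int_h^{r_1}(1-\Pr{}^{\mathrm L}(u))2\pi u\lambda\,du\Big)\exp\Big(-\int_h^{r}\Pr{}^{\mathrm L}(u)2\pi u\lambda\,du\Big)\Pr{}^{\mathrm L}(r)\,2\pi r\lambda,$$ $$f^{\mathrm{NL}}(r)=\exp\Big(-\int_h^{r_2}\Pr{}^{\mathrm L}(u)2\pi u\lambda\,du\Big)\exp\Big(-\int_h^{r}(1-\Pr{}^{\mathrm L}(u))2\pi u\lambda\,du\Big)(1-\Pr{}^{\mathrm L}(r))\,2\pi r\lambda,$$ where an integral from $h$ to $r_1$ (or $r_2$) is read as $0$ if $r_1<h$ (or $r_2<h$). **Theorem 1.** Almost surely there is exactly one UAV with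 the strongest signal. The functions $f^{\mathrm L}$ and $f^{\mathrm{NL}}$ on $[h,\infty)$ are the densities of the serving distance jointly with the link type: for every Borel set $B$, the probability that the serving link is LoS (NLoS) and its length lies in $B$ is $\int_{B\cap[h,\infty)}f^{\mathrm L}(r)\,dr$ (resp. with $f^{\mathrm{NL}}$). Moreover $$p^{\mathrm{cov}}_{\mathrm{lower}}(\lambda,\gamma)=T^{\mathrm L}+T^{\mathrm{NL}},\qquad T^{\bullet}=\int_h^\infty\Pr\Big[\frac{P\zeta^{\bullet}(r)g}{I_r+N_0}>\gamma\Big]f^{\bullet}(r)\,dr\quad(\bullet\in\{\mathrm L,\mathrm{NL}\}),$$ where $(g,I_r)$ has the conditional law of the serving gain and the interference given that the serving link is of type $\bullet$ and has length $r$; and for almost every $r\ge h$ at which a link has type $\bullet$ with positive probability, $$\Pr\Big[\frac{P\zeta^{\bullet}(r)g}{I_r+N_0}>\gamma\Big]=\exp\Big(-\frac{\gamma N_0}{P\zeta^{\bullet}(r)}\Big)\,\mathcal L_{I_r}\Big(\frac{\gamma}{P\zeta^{\bullet}(r)}\Big),$$ where $\mathcal L_{I_r}(s)=\mathbb E[e^{-sI_r}]$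 (with $e^{-\infty}=0$) is the Laplace transform of that conditional law of the interference. Consequently $$p^{\mathrm{cov}}_{\mathrm{lower}}(\lambda,\gamma)=\sum_{\bullet\in\{\mathrm L,\mathrm{NL}\}}\int_h^\infty\exp\Big(-\frac{\gamma N_0}{P\zeta^{\bullet}(r)}\Big)\,\mathcal L_{I_r}\Big(\frac{\gamma}{P\zeta^{\bullet}(r)}\Big)f^{\bullet}(r)\,dr.$$ -/

import Mathlib

open MeasureTheory ProbabilityTheory Set
open scoped ENNReal NNReal

noncomputable section

namespace UAV

/-- The horizontal plane `ℝ²`: it carries the users (at height `0`) and, lifted to height `h`,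
the UAVs; a UAV at `(x₀, x₁, h)` is recorded by its horizontal coordinates `x`. -/
abbrev Plane : Type := EuclideanSpace ℝ (Fin 2)

/-- Number of points of the enumerated configuration `x` that lie in `B`. -/
def count {E : Type*} (x : ℕ → E) (B : Set E) : ℕ∞ := {i : ℕ | x i ∈ B}.encard

/-- The random points `X 0, X 1, …` form a Poisson point process with intensity measure `ν`
(a process with infinitely many points, enumerated in an arbitrary measurable way):
the number of points in a set `B` of finite intensity is Poisson with mean `ν B`, and
the numbers of points in pairwise disjoint sets are independent. -/
structure IsPoissonProcess {Ω E : Type*} [MeasurableSpace Ω] [MeasurableSpace E]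
    (X : ℕ → Ω → E) (ν : Measure E) (μ : Measure Ω) : Prop where
  measurable : ∀ i, Measurable (X i)
  count_law : ∀ B : Set E, MeasurableSet B → ν B ≠ ∞ → ∀ n : ℕ,
    μ {ω | count (fun i => X i ω) B = (n : ℕ∞)} = poissonMeasure (ν B).toNNReal {n}
  count_indep : ∀ (n : ℕ) (B : Fin n → Set E), (∀ k, MeasurableSet (B k)) →
    Pairwise (fun k l => Disjoint (B k) (B l)) →
    iIndepFun (fun k ω => count (fun i => X i ω) (B k)) μ

/-- The deterministic parameters of the network. -/
structure Params where
  /-- density of the UAVs -/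
  lam : ℝ
  /-- height of the UAVs -/
  h : ℝ
  /-- transmit power -/
  P : ℝ
  /-- noise power -/
  N0 : ℝ
  /-- LoS path loss at reference distance `1` -/
  AL : ℝ
  /-- NLoS path loss at reference distance `1` -/
  ANL : ℝ
  /-- LoS path loss exponent -/
  aL : ℝ
  /-- NLoS path loss exponent -/
  aNL : ℝ
  /-- LoS probability as a function of the 3D distance -/
  prL : ℝ → ℝ

variable (p : Params)

/-- LoS path loss function `ζ^L(r) = A^L r^{-α^L}`. -/
def zetaL (r : ℝ) : ℝ := p.AL * r ^ (-p.aL)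

/-- NLoS path loss function `ζ^NL(r) = A^NL r^{-α^NL}`. -/
def zetaNL (r : ℝ) : ℝ := p.ANL * r ^ (-p.aNL)

/-- Path loss of a link of given type (`true` is LoS, `false` is NLoS) and 3D length `r`. -/
def zeta (los : Bool) (r : ℝ) : ℝ := if los then zetaL p r else zetaNL p r

/-- Probability that a link of 3D length `r` has the given type. -/
def linkProb (los : Bool) (r : ℝ) : ℝ := if los then p.prL r else 1 - p.prL r

/-- 3D distance from the ground user `(y, 0)` to the UAV `(x, h)`. -/
def dist3 (y x : Plane) : ℝ := Real.sqrt (dist x y ^ 2 + p.h ^ 2)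

section Random

variable {Ω : Type*} [MeasurableSpace Ω]
  (X : ℕ → Ω → Plane) (los : ℕ → Ω → Bool) (g : ℕ → Ω → ℝ) (y : Plane)

/-- The random model, seen from the user at `y`: the UAVs `X i` form a homogeneous Poisson point
process of density `lam`; given the positions, the link types `los i` are independent and
link `i` is LoS with probability `prL (r i)`, where `r i` is its 3D length; the channel gains `g i`
are i.i.d. exponential of mean one and independent of positions and link types. -/
structure IsNetwork (μ : Measure Ω) : Prop where
  poisson : IsPoissonProcess X (ENNReal.ofReal p.lam • (volume : Measure Plane)) μ
  los_measurable : ∀ i, Measurable (los i)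
  los_law : ∀ (s : Finset ℕ) (ℓ : ℕ → Bool) (A : Set (ℕ → Plane)), MeasurableSet A →
    μ ({ω | (fun i => X i ω) ∈ A} ∩ {ω | ∀ i ∈ s, los i ω = ℓ i}) =
      ∫⁻ ω in {ω | (fun i => X i ω) ∈ A},
        ∏ i ∈ s, ENNReal.ofReal (linkProb p (ℓ i) (dist3 p y (X i ω))) ∂μ
  gain_measurable : ∀ i, Measurable (g i)
  gain_law : ∀ i, μ.map (g i) = expMeasure 1
  gain_iIndep : iIndepFun g μ
  gain_indep : IndepFun (fun ω i => g i ω) (fun ω i => (X i ω, los i ω)) μ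

/-- Path loss `β_i` of the link between the user at `y` and UAV `i`. -/
def beta (i : ℕ) (ω : Ω) : ℝ := zeta p (los i ω) (dist3 p y (X i ω))

/-- UAV `i` provides the strongest (mean) received signal. -/
def IsStrongest (ω : Ω) (i : ℕ) : Prop :=
  ∀ j, p.P * beta p X los y j ω ≤ p.P * beta p X los y i ω

/-- The serving UAV `b_o`: the (almost surely unique) one with the strongest signal. -/
def serving (ω : Ω) : ℕ := sInf {i | IsStrongest p X los y ω i}

/-- Type and 3D length of the serving link. -/
def servingLink (ω : Ω) : Bool × ℝ :=
  (los (serving p X los y ω) ω, dist3 p y (X (serving p X los y ω) ω))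

/-- Interference `∑_{i ≠ b_o} P β_i g_i`, with values in `[0, ∞]`. -/
def interference (ω : Ω) : ℝ≥0∞ :=
  ∑' i, if i = serving p X los y ω then 0
    else ENNReal.ofReal (p.P * beta p X los y i ω * g i ω)

/-- The value `P g ζ / (I + N₀)` of the SINR of a link with path loss `z`, channel gain `c` and
interference `I`. -/
def sinrValue (z c : ℝ) (I : ℝ≥0∞) : ℝ≥0∞ :=
  ENNReal.ofReal (p.P * z * c) / (I + ENNReal.ofReal p.N0)

/-- The SINR of the user at `y`, served by the strongest UAV. -/
def sinr (ω : Ω) : ℝ≥0∞ :=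
  sinrValue p (beta p X los y (serving p X los y ω) ω) (g (serving p X los y ω) ω)
    (interference p X los g y ω)

/-- Coverage probability `Pr(SINR > γ)`. -/
def coverage (μ : Measure Ω) (γ : ℝ) : ℝ≥0∞ :=
  μ {ω | ENNReal.ofReal γ < sinr p X los g y ω}

/-- `Pr[P ζ(r) g / (I_r + N₀) > γ]`: here `(g, I_r)` has the conditional law of the serving gain
and of the interference given that the serving link has the given type and 3D length `r`. -/
def condCoverage (μ : Measure Ω) [IsFiniteMeasure μ] (γ : ℝ) (t : Bool) (r : ℝ) : ℝ≥0∞ :=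
  condDistrib (fun ω => (g (serving p X los y ω) ω, interference p X los g y ω))
    (servingLink p X los y) μ (t, r)
    {x : ℝ × ℝ≥0∞ | ENNReal.ofReal γ < sinrValue p (zeta p t r) x.1 x.2}

/-- Laplace transform `ℒ_{I_r}(s) = E[exp (-s I_r)]` (with `exp (-∞) = 0`) of the interference `I_r`
given that the serving link has the given type and 3D length `r`. -/
def laplaceI (μ : Measure Ω) [IsFiniteMeasure μ] (t : Bool) (r s : ℝ) : ℝ≥0∞ :=
  ∫⁻ x, EReal.exp (-((ENNReal.ofReal s * x : ℝ≥0∞) : EReal))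
    ∂(condDistrib (interference p X los g y) (servingLink p X los y) μ (t, r))

/-- The product `exp (-γ N₀ / (P ζ(r))) ℒ_{I_r}(γ / (P ζ(r)))`. -/
def noiseLaplace (μ : Measure Ω) [IsFiniteMeasure μ] (γ : ℝ) (t : Bool) (r : ℝ) : ℝ≥0∞ :=
  ENNReal.ofReal (Real.exp (-(γ * p.N0 / (p.P * zeta p t r)))) *
    laplaceI p X los g y μ t r (γ / (p.P * zeta p t r))

end Random

/-- Serving-distance density, LoS case; `r₁` is the NLoS distance of equal signal strength.
The integrals are over `h ≤ u ≤ r₁` and `h ≤ u ≤ r`; the first is `0` if `r₁ < h`. -/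
def fL (r₁ : ℝ → ℝ) (r : ℝ) : ℝ :=
  Real.exp (-∫ u in Icc p.h (r₁ r), (1 - p.prL u) * (2 * Real.pi * u * p.lam)) *
    Real.exp (-∫ u in Icc p.h r, p.prL u * (2 * Real.pi * u * p.lam)) *
    p.prL r * (2 * Real.pi * r * p.lam)

/-- Serving-distance density, NLoS case; `r₂` is the LoS distance of equal signal strength. -/
def fNL (r₂ : ℝ → ℝ) (r : ℝ) : ℝ :=
  Real.exp (-∫ u in Icc p.h (r₂ r), p.prL u * (2 * Real.pi * u * p.lam)) *
    Real.exp (-∫ u in Icc p.h r, (1 - p.prL u) * (2 * Real.pi * u * p.lam)) *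
    (1 - p.prL r) * (2 * Real.pi * r * p.lam)

end UAV

end

/-!
The serving link is found from the nearest LoS link and the nearest NLoS link, at distances `R_L`
and `R_NL` (possibly `∞`): it is the LoS one, of length `r`, when `R_L = r` and `R_NL ≥ r₁(r)`.
The theorem rests on the joint law of `(R_L, R_NL)` and on the independence of the gains.

*Void probabilities.* From the Poisson counts alone, `E[∏ᵢ (1 - q (Xᵢ))] = exp (-∫ q dν)` for
measurable `0 ≤ q ≤ 1` (`lintegral_infProd_one_sub`): step functions reduce to independent Poisson
counts, and the general case follows by monotone approximation. Summing out the link types given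
the positions turns this into the probability that no link of type `t` has its length in `A t`
(`measure_forall_notMem`), which is `exp (-∑ₜ Λₜ (A t))` with `dΛₜ = rate t r dr` on `[h, ∞)`.
Applied to bounded intervals of distances it gives
`P(R_L ≥ a, R_NL ≥ b) = exp (-Λ_L [h, a)) exp (-Λ_NL [h, b))`, so `R_L` and `R_NL` are independent
(`indepFun_nearest`). The law of `R_t` on `[h, ∞)` has the density `rate t r * exp (-Λₜ [h, r])`
(`map_nearest_restrict`); as `rate` is only measurable, this uses the fundamental theorem of
calculus for absolutely continuous functions.

*Uniqueness and the densities.* Two UAVs are almost surely never equally far away, because a shell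
of small intensity `m` contains two of them with probability at most `m²`; and a tie between the
two nearest links of different types has probability zero by independence. This gives the unique
strongest UAV, and integrating `P(R_NL ≥ r₁(r))` over the law of `R_L` gives `fL`, likewise `fNL`
(`measure_servingLink_mem`).

*Coverage.* Which UAV `i` serves depends on positions and types only, and the interference then
only on the gains `g j` with `j ≠ i`. So the serving gain is exponential and independent of the
pair formed by the serving link and the interference (`measure_serving_gain_inter`), and the
conditional law of gain and interference given the serving link is a product
(`condDistrib_gain_interference`). Integrating out the gain leaves
`exp (-γ (I + N₀) / (P ζ))`, whose mean is the noise factor times the Laplace transform.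
-/

namespace UAV

open Filter Topology

section

/-! ### The exponential `exp (-a)` of an extended nonnegative number -/

/-- `exp (-a)` for `a ∈ [0, ∞]`, with `exp (-∞) = 0`. -/
noncomputable def expNeg (a : ℝ≥0∞) : ℝ≥0∞ := EReal.exp (-(a : EReal))

@[simp] lemma expNeg_zero : expNeg 0 = 1 := by simp [expNeg]

lemma expNeg_ofReal {a : ℝ} (ha : 0 ≤ a) :
    expNeg (ENNReal.ofReal a) = ENNReal.ofReal (Real.exp (-a)) := by
  rw [expNeg, EReal.coe_ennreal_ofReal, max_eq_left ha, ← EReal.coe_neg, EReal.exp_coe]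

lemma expNeg_add (a b : ℝ≥0∞) : expNeg (a + b) = expNeg a * expNeg b := by
  rw [expNeg, expNeg, expNeg, ← EReal.exp_add, EReal.coe_ennreal_add, EReal.neg_add]
  · rfl
  · exact Or.inl (by simp)
  · exact Or.inr (by simp)

lemma expNeg_sum {ι : Type*} (s : Finset ι) (f : ι → ℝ≥0∞) :
    expNeg (∑ i ∈ s, f i) = ∏ i ∈ s, expNeg (f i) := by
  classical
  induction s using Finset.induction_on with
  | empty => simp
  | insert a s ha ih => rw [Finset.sum_insert ha, Finset.prod_insert ha, expNeg_add, ih]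

lemma continuous_expNeg : Continuous expNeg :=
  ENNReal.continuous_exp.comp (continuous_neg.comp continuous_coe_ennreal_ereal)

lemma expNeg_antitone : Antitone expNeg := fun _ _ hab =>
  EReal.exp_monotone (EReal.neg_le_neg_iff.2 (EReal.coe_ennreal_le_coe_ennreal_iff.2 hab))

lemma expNeg_le_one (a : ℝ≥0∞) : expNeg a ≤ 1 := by
  simpa using expNeg_antitone (zero_le (a := a))

/-! ### Infinite products of factors in `[0, 1]` -/

/-- The product of a sequence of numbers in `[0, 1]`, as the infimum of its partial products. -/
noncomputable def infProd (a : ℕ → ℝ≥0∞) : ℝ≥0∞ := ⨅ n, ∏ i ∈ Finset.range n, a i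

lemma antitone_prod_range {a : ℕ → ℝ≥0∞} (ha : ∀ i, a i ≤ 1) :
    Antitone fun n => ∏ i ∈ Finset.range n, a i :=
  antitone_nat_of_succ_le fun n => by
    rw [Finset.prod_range_succ]
    exact mul_le_of_le_one_right zero_le (ha n)

lemma tendsto_infProd {a : ℕ → ℝ≥0∞} (ha : ∀ i, a i ≤ 1) :
    Tendsto (fun n => ∏ i ∈ Finset.range n, a i) atTop (𝓝 (infProd a)) :=
  tendsto_atTop_iInf (antitone_prod_range ha)

lemma infProd_le_one (a : ℕ → ℝ≥0∞) : infProd a ≤ 1 :=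
  (iInf_le _ 0).trans (by simp)

lemma infProd_finset_prod {ι : Type*} (s : Finset ι) {a : ι → ℕ → ℝ≥0∞}
    (ha : ∀ k i, a k i ≤ 1) :
    infProd (fun i => ∏ k ∈ s, a k i) = ∏ k ∈ s, infProd (a k) := by
  refine tendsto_nhds_unique (tendsto_infProd fun i => Finset.prod_le_one' fun k _ => ha k i) ?_
  have h := ENNReal.tendsto_finsetProd_of_ne_top s (fun k _ => tendsto_infProd (ha k))
    (fun k _ => ne_top_of_le_ne_top ENNReal.one_ne_top (infProd_le_one _))
  refine h.congr fun n => ?_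
  rw [Finset.prod_comm]

/-- A sequence with the value `c` on a finite set and `1` elsewhere has product `c` to the power
of the cardinality. -/
lemma infProd_ite (S : Set ℕ) [DecidablePred (· ∈ S)] (hS : S.Finite) {c : ℝ≥0∞} (hc : c ≤ 1) :
    infProd (fun i => if i ∈ S then c else 1) = c ^ S.encard.toNat := by
  have h1 : ∀ i, (if i ∈ S then c else 1) ≤ 1 := fun i => by split_ifs <;> simp [hc]
  refine tendsto_nhds_unique (tendsto_infProd h1) (tendsto_const_nhds.congr' ?_)
  obtain ⟨N, hN⟩ := hS.bddAbove
  filter_upwards [eventually_gt_atTop N] with n hn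
  rw [Finset.prod_ite, Finset.prod_const, Finset.prod_const_one, mul_one, ← Set.ncard_def,
    Set.ncard_eq_toFinset_card S hS]
  congr 2
  ext i
  simp only [Finite.mem_toFinset, Finset.mem_filter, Finset.mem_range]
  exact ⟨fun h => ⟨(hN h).trans_lt hn, h⟩, fun h => h.2⟩

lemma measurable_infProd {Ω : Type*} [MeasurableSpace Ω] {f : ℕ → Ω → ℝ≥0∞}
    (hf : ∀ i, Measurable (f i)) : Measurable fun ω => infProd fun i => f i ω :=
  Measurable.iInf fun _ => Finset.measurable_fun_prod _ fun i _ => hf i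

/-! ### The probability generating functional of a Poisson process -/

/-- Probability generating function of the Poisson distribution. -/
lemma tsum_poissonMeasure_mul_pow (m : ℝ≥0) {c : ℝ≥0∞} (hc : c ≤ 1) :
    ∑' n : ℕ, c ^ n * poissonMeasure m {n} = expNeg ((1 - c) * m) := by
  lift c to ℝ≥0 using ne_top_of_le_ne_top ENNReal.one_ne_top hc
  have hc' : (c : ℝ) ≤ 1 := by exact_mod_cast hc
  have h1 : ∀ n : ℕ, (c : ℝ≥0∞) ^ n * poissonMeasure m {n} =
      ENNReal.ofReal (Real.exp (-m) * ((c * m : ℝ) ^ n / n.factorial)) := fun n => by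
    rw [poissonMeasure_singleton, ← ENNReal.ofReal_coe_nnreal (p := c),
      ← ENNReal.ofReal_pow c.coe_nonneg, ← ENNReal.ofReal_mul (by positivity)]
    congr 1
    rw [mul_pow]
    ring
  have h2 : HasSum (fun n : ℕ => Real.exp (-m) * ((c * m : ℝ) ^ n / n.factorial))
      (Real.exp (-m) * Real.exp (c * m)) := by
    rw [Real.exp_eq_exp_ℝ]
    exact (NormedSpace.expSeries_div_hasSum_exp (c * m : ℝ)).mul_left _
  simp_rw [h1]
  rw [← ENNReal.ofReal_tsum_of_nonneg (fun n => by positivity) h2.summable, h2.tsum_eq,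
    ← Real.exp_add]
  have h3 : (1 - (c : ℝ≥0∞)) * m = ENNReal.ofReal ((1 - c) * m) := by
    rw [ENNReal.ofReal_mul (by linarith), ENNReal.ofReal_sub _ c.coe_nonneg]
    simp
  rw [h3, expNeg_ofReal (mul_nonneg (by linarith) m.coe_nonneg)]
  congr 2
  ring

variable {Ω E : Type*} [MeasurableSpace Ω] [MeasurableSpace E] {X : ℕ → Ω → E} {ν : Measure E}
  {μ : Measure Ω}

/-- At least `n` points lie in `B` if and only if all points with index in some `n`-element set do,
which is a countable union of events. -/
lemma measurable_count (hX : ∀ i, Measurable (X i)) {B : Set E} (hB : MeasurableSet B) :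
    Measurable fun ω => count (fun i => X i ω) B := by
  have hle : ∀ n : ℕ, MeasurableSet {ω | (n : ℕ∞) ≤ count (fun i => X i ω) B} := fun n => by
    have : {ω | (n : ℕ∞) ≤ count (fun i => X i ω) B} =
        ⋃ (t : Finset ℕ) (_ : t.card = n), ⋂ i ∈ t, X i ⁻¹' B := by
      ext ω
      simp only [mem_ofPred_eq, mem_iUnion, mem_iInter, mem_preimage, exists_prop, count]
      constructor
      · intro h
        obtain ⟨t, ht, htn⟩ := Set.exists_subset_encard_eq h
        have hfin : t.Finite := Set.finite_of_encard_eq_coe htn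
        refine ⟨hfin.toFinset, ?_, fun i hi => ht (hfin.mem_toFinset.1 hi)⟩
        rw [hfin.encard_eq_coe_toFinset_card] at htn
        exact_mod_cast htn
      · rintro ⟨t, rfl, ht⟩
        rw [← Set.encard_coe_eq_coe_finsetCard]
        exact Set.encard_le_encard fun i hi => ht i hi
    rw [this]
    exact MeasurableSet.iUnion fun t => MeasurableSet.iUnion fun _ =>
      Finset.measurableSet_biInter _ fun i _ => hX i hB
  refine measurable_to_countable' fun k => ?_
  induction k with
  | top =>
    have : (fun ω => count (fun i => X i ω) B) ⁻¹' {⊤} =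
        ⋂ n : ℕ, {ω | (n : ℕ∞) ≤ count (fun i => X i ω) B} := by
      ext ω
      simp only [mem_preimage, mem_singleton_iff, mem_iInter, mem_ofPred_eq]
      exact ⟨fun h n => h ▸ le_top, fun h => ENat.eq_top_iff_forall_ge.2 h⟩
    rw [this]
    exact MeasurableSet.iInter hle
  | coe n =>
    have : (fun ω => count (fun i => X i ω) B) ⁻¹' {(n : ℕ∞)} =
        {ω | (n : ℕ∞) ≤ count (fun i => X i ω) B} \
          {ω | ((n + 1 : ℕ) : ℕ∞) ≤ count (fun i => X i ω) B} := by
      ext ω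
      simp only [mem_preimage, mem_singleton_iff, Set.mem_sdiff, mem_ofPred_eq, not_le]
      rw [Nat.cast_add, Nat.cast_one, ENat.lt_add_one_iff (ENat.natCast_ne_top n)]
      exact ⟨fun h => ⟨h.ge, h.le⟩, fun h => le_antisymm h.2 h.1⟩
    rw [this]
    exact (hle n).diff (hle _)

/-- The number of points in a set of finite intensity is almost surely finite, since the Poisson
probabilities of the finite values sum to one; so its law is the Poisson law. -/
lemma lintegral_comp_count (hX : IsPoissonProcess X ν μ) {B : Set E} (hB : MeasurableSet B)
    (hν : ν B ≠ ∞) [IsProbabilityMeasure μ] (f : ℕ∞ → ℝ≥0∞) :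
    ∫⁻ ω, f (count (fun i => X i ω) B) ∂μ =
      ∑' n : ℕ, f n * poissonMeasure (ν B).toNNReal {n} := by
  have hm := measurable_count hX.measurable hB
  have hlaw : μ.map (fun ω => count (fun i => X i ω) B) =
      (poissonMeasure (ν B).toNNReal).map ((↑) : ℕ → ℕ∞) := by
    have hp : IsProbabilityMeasure (μ.map fun ω => count (fun i => X i ω) B) :=
      Measure.isProbabilityMeasure_map hm.aemeasurable
    have hp' : IsProbabilityMeasure
        ((poissonMeasure (ν B).toNNReal).map ((↑) : ℕ → ℕ∞)) :=
      Measure.isProbabilityMeasure_map (measurable_from_nat).aemeasurable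
    have hs : ∀ n : ℕ, μ.map (fun ω => count (fun i => X i ω) B) {(n : ℕ∞)} =
        (poissonMeasure (ν B).toNNReal).map ((↑) : ℕ → ℕ∞) {(n : ℕ∞)} := fun n => by
      rw [Measure.map_apply hm (measurableSet_singleton _),
        Measure.map_apply measurable_from_nat (measurableSet_singleton _)]
      have h1 : ((↑) : ℕ → ℕ∞) ⁻¹' {(n : ℕ∞)} = {n} := by ext k; simp
      rw [h1, ← hX.count_law B hB hν n]
      rfl
    have hr : MeasurableSet (range ((↑) : ℕ → ℕ∞)) := MeasurableSet.of_discrete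
    have hsub : ∀ s ⊆ range ((↑) : ℕ → ℕ∞),
        μ.map (fun ω => count (fun i => X i ω) B) s =
        (poissonMeasure (ν B).toNNReal).map ((↑) : ℕ → ℕ∞) s := fun s hs' => by
      rw [← Measure.tsum_indicator_apply_singleton _ s MeasurableSet.of_discrete,
        ← Measure.tsum_indicator_apply_singleton _ s MeasurableSet.of_discrete]
      refine tsum_congr fun k => ?_
      by_cases hk : k ∈ s
      · obtain ⟨n, rfl⟩ := hs' hk
        simp only [indicator_of_mem hk]
        exact hs n
      · simp [hk]
    have hfull : (poissonMeasure (ν B).toNNReal).map ((↑) : ℕ → ℕ∞) (range ((↑) : ℕ → ℕ∞)) = 1 := by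
      rw [Measure.map_apply measurable_from_nat hr, preimage_range, measure_univ]
    refine Measure.ext fun s _ => ?_
    rw [← measure_inter_conull (t := range ((↑) : ℕ → ℕ∞)),
      ← measure_inter_conull (μ := (poissonMeasure (ν B).toNNReal).map ((↑) : ℕ → ℕ∞))
        (t := range ((↑) : ℕ → ℕ∞)), hsub _ inter_subset_right]
    · exact (prob_compl_eq_zero_iff hr).2 hfull
    · exact (prob_compl_eq_zero_iff hr).2 ((hsub _ subset_rfl).trans hfull)
  calc ∫⁻ ω, f (count (fun i => X i ω) B) ∂μ
      = ∫⁻ k, f k ∂(μ.map fun ω => count (fun i => X i ω) B) :=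
        (lintegral_map (measurable_from_top) hm).symm
    _ = ∑' n : ℕ, f n * poissonMeasure (ν B).toNNReal {n} := by
        rw [hlaw, lintegral_map measurable_from_top measurable_from_nat, lintegral_countable']

lemma ae_finite_of_ne_top (hX : IsPoissonProcess X ν μ) [IsProbabilityMeasure μ] {B : Set E}
    (hB : MeasurableSet B) (hν : ν B ≠ ∞) : ∀ᵐ ω ∂μ, {i | X i ω ∈ B}.Finite := by
  have h := lintegral_comp_count hX hB hν fun k => if k = ⊤ then 1 else 0
  simp only [ENat.natCast_ne_top, if_false, zero_mul, tsum_zero] at h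
  have hm : Measurable fun k : ℕ∞ => if k = ⊤ then (1 : ℝ≥0∞) else 0 := measurable_from_top
  have h' := (lintegral_eq_zero_iff (hm.comp (measurable_count hX.measurable hB))).1 h
  filter_upwards [h'] with ω hω
  by_contra hinf
  have : count (fun i => X i ω) B = ⊤ := Set.encard_eq_top hinf
  simp [this] at hω

open Classical in
/-- The generating functional of a Poisson process on a finite step function. -/
lemma lintegral_infProd_ite (hX : IsPoissonProcess X ν μ) [IsProbabilityMeasure μ] {n : ℕ}
    {B : Fin n → Set E} (hB : ∀ k, MeasurableSet (B k))
    (hd : Pairwise fun k l => Disjoint (B k) (B l)) (hν : ∀ k, ν (B k) ≠ ∞)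
    {c : Fin n → ℝ≥0∞} (hc : ∀ k, c k ≤ 1) :
    ∫⁻ ω, infProd (fun i => ∏ k, if X i ω ∈ B k then c k else 1) ∂μ =
      ∏ k, expNeg ((1 - c k) * ν (B k)) := by
  have h1 : ∀ᵐ ω ∂μ, infProd (fun i => ∏ k, if X i ω ∈ B k then c k else 1) =
      ∏ k, c k ^ (count (fun i => X i ω) (B k)).toNat := by
    filter_upwards [ae_all_iff.2 fun k => ae_finite_of_ne_top hX (hB k) (hν k)] with ω hω
    rw [infProd_finset_prod _ fun k i => by split_ifs <;> simp [hc]]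
    exact Finset.prod_congr rfl fun k _ => infProd_ite {i | X i ω ∈ B k} (hω k) (hc k)
  rw [lintegral_congr_ae h1]
  have hm : ∀ k, Measurable fun j : ℕ∞ => c k ^ j.toNat := fun k => measurable_from_top
  have hind : iIndepFun (fun k ω => c k ^ (count (fun i => X i ω) (B k)).toNat) μ :=
    (hX.count_indep n B hB hd).comp (fun k (j : ℕ∞) => c k ^ j.toNat) hm
  rw [lintegral_prod_eq_prod_lintegral_of_indepFun _ _ hind
    fun k => (hm k).comp (measurable_count hX.measurable (hB k))]
  refine Finset.prod_congr rfl fun k _ => ?_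
  rw [lintegral_comp_count hX (hB k) (hν k) fun j => c k ^ j.toNat]
  simp only [ENat.toNat_natCast]
  rw [tsum_poissonMeasure_mul_pow _ (hc k), ENNReal.coe_toNNReal (hν k)]

/-- The generating functional of a Poisson process on a simple function of finite support. -/
lemma lintegral_infProd_simpleFunc (hX : IsPoissonProcess X ν μ) [IsProbabilityMeasure μ]
    (q : SimpleFunc E ℝ≥0∞) (hν : ν {x | q x ≠ 0} ≠ ∞) (hq : ∀ x, q x ≤ 1) :
    ∫⁻ ω, infProd (fun i => 1 - q (X i ω)) ∂μ = expNeg (∫⁻ x, q x ∂ν) := by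
  classical
  -- The value `0` is left out: its level set may have infinite intensity.
  set s : Finset ℝ≥0∞ := q.range.erase 0 with hs
  have key := lintegral_infProd_ite hX (n := s.card)
    (B := fun k => q ⁻¹' {(s.equivFin.symm k : ℝ≥0∞)})
    (c := fun k => 1 - (s.equivFin.symm k : ℝ≥0∞))
    (fun k => q.measurableSet_fiber _)
    (fun k l hkl => by
      refine Disjoint.preimage _ (disjoint_singleton.2 fun h => hkl ?_)
      exact s.equivFin.symm.injective (Subtype.ext h))
    (fun k => by
      refine ne_top_of_le_ne_top hν (measure_mono fun x hx => ?_)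
      have := (s.equivFin.symm k).2
      replace this := Finset.mem_erase.1 this
      rw [mem_preimage, mem_singleton_iff] at hx
      simpa [hx] using this.1)
    (fun k => tsub_le_self)
  have e1 : ∀ (F : ℝ≥0∞ → ℝ≥0∞), ∏ k, F (s.equivFin.symm k : ℝ≥0∞) = ∏ c ∈ s, F c := fun F => by
    rw [← Finset.prod_coe_sort s F]
    exact s.equivFin.symm.prod_comp fun c : s => F c
  have e2 : ∀ x, (∏ k, if x ∈ q ⁻¹' {(s.equivFin.symm k : ℝ≥0∞)}
      then 1 - (s.equivFin.symm k : ℝ≥0∞) else 1) = 1 - q x := fun x => by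
    rw [e1 fun c => if x ∈ q ⁻¹' {c} then 1 - c else 1]
    simp only [mem_preimage, mem_singleton_iff]
    rw [Finset.prod_ite_eq]
    split_ifs with h
    · rfl
    · have : q x = 0 := by
        by_contra h0
        exact h (Finset.mem_erase.2 ⟨h0, q.mem_range_self x⟩)
      simp [this]
  simp only [e2] at key
  rw [key, e1 fun c => expNeg ((1 - (1 - c)) * ν (q ⁻¹' {c})), ← expNeg_sum]
  congr 1
  rw [SimpleFunc.lintegral_eq_lintegral, SimpleFunc.lintegral]
  rw [← Finset.sum_erase (a := (0 : ℝ≥0∞)) q.range (by simp)]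
  refine Finset.sum_congr rfl fun c hc => ?_
  obtain ⟨x, rfl⟩ := SimpleFunc.mem_range.1 (Finset.mem_of_mem_erase hc)
  rw [ENNReal.sub_sub_cancel ENNReal.one_ne_top (hq x)]

/-- **Probability generating functional** of a Poisson process:
`E[∏ᵢ (1 - q (Xᵢ))] = exp (-∫ q dν)` for measurable `q` with values in `[0, 1]`. -/
theorem lintegral_infProd_one_sub (hX : IsPoissonProcess X ν μ) [IsProbabilityMeasure μ]
    [SigmaFinite ν] {q : E → ℝ≥0∞} (hqm : Measurable q) (hq : ∀ x, q x ≤ 1) :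
    ∫⁻ ω, infProd (fun i => 1 - q (X i ω)) ∂μ = expNeg (∫⁻ x, q x ∂ν) := by
  classical
  -- Simple functions increasing to `q`, cut off to sets of finite intensity.
  set Q : ℕ → SimpleFunc E ℝ≥0∞ := fun k =>
    (SimpleFunc.eapprox q k).restrict (spanningSets ν k) with hQ
  have hQv : ∀ k x, Q k x = (spanningSets ν k).indicator (SimpleFunc.eapprox q k) x := fun k x => by
    rw [hQ]
    simp only [SimpleFunc.restrict_apply _ (measurableSet_spanningSets ν k)]
  have hmono : ∀ x, Monotone fun k => Q k x := fun x k l hkl => by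
    simp only [hQv]
    by_cases hx : x ∈ spanningSets ν k
    · rw [indicator_of_mem hx, indicator_of_mem (monotone_spanningSets ν hkl hx)]
      exact SimpleFunc.monotone_eapprox q hkl x
    · rw [indicator_of_notMem hx]
      exact zero_le
  have hle : ∀ k x, Q k x ≤ q x := fun k x => by
    rw [hQv]
    refine (indicator_le_self _ _ x).trans ?_
    rw [← SimpleFunc.iSup_eapprox_apply hqm x]
    exact le_iSup (fun k => SimpleFunc.eapprox q k x) k
  have hlim : ∀ x, Tendsto (fun k => Q k x) atTop (𝓝 (q x)) := fun x => by
    have h1 : Tendsto (fun k => SimpleFunc.eapprox q k x) atTop (𝓝 (q x)) := by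
      rw [← SimpleFunc.iSup_eapprox_apply hqm x]
      exact tendsto_atTop_iSup fun k l hkl => SimpleFunc.monotone_eapprox q hkl x
    refine h1.congr' ?_
    obtain ⟨N, hN⟩ := mem_iUnion.1 ((iUnion_spanningSets ν).symm ▸ mem_univ x :
      x ∈ ⋃ n, spanningSets ν n)
    filter_upwards [eventually_ge_atTop N] with k hk
    rw [hQv, indicator_of_mem (monotone_spanningSets ν hk hN)]
  have hfin : ∀ k, ∫⁻ ω, infProd (fun i => 1 - Q k (X i ω)) ∂μ = expNeg (∫⁻ x, Q k x ∂ν) :=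
    fun k => lintegral_infProd_simpleFunc hX (Q k)
      (ne_top_of_le_ne_top (measure_spanningSets_lt_top ν k).ne (measure_mono fun x hx => by
        by_contra h
        exact hx (by rw [hQv, indicator_of_notMem h])))
      fun x => (hle k x).trans (hq x)
  have hR : Tendsto (fun k => expNeg (∫⁻ x, Q k x ∂ν)) atTop (𝓝 (expNeg (∫⁻ x, q x ∂ν))) :=
    (continuous_expNeg.tendsto _).comp (lintegral_tendsto_of_tendsto_of_monotone
      (fun k => (Q k).measurable.aemeasurable) (ae_of_all _ hmono) (ae_of_all _ hlim))
  -- Both limits are decreasing, so the infima over `k` and over the partial products commute.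
  have hpt : ∀ ω, infProd (fun i => 1 - q (X i ω)) =
      ⨅ k, infProd fun i => 1 - Q k (X i ω) := fun ω => by
    unfold infProd
    rw [iInf_comm]
    refine iInf_congr fun n => ?_
    have hanti : Antitone fun k => ∏ i ∈ Finset.range n, (1 - Q k (X i ω)) := fun k l hkl =>
      Finset.prod_le_prod' fun i _ => tsub_le_tsub_left (hmono _ hkl) _
    refine tendsto_nhds_unique ?_ (tendsto_atTop_iInf hanti)
    refine ENNReal.tendsto_finsetProd_of_ne_top _ (fun i _ => ?_) fun i _ => by simp
    exact ENNReal.Tendsto.sub tendsto_const_nhds (hlim _) (Or.inl ENNReal.one_ne_top)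
  have hL : ∫⁻ ω, infProd (fun i => 1 - q (X i ω)) ∂μ =
      ⨅ k, ∫⁻ ω, infProd (fun i => 1 - Q k (X i ω)) ∂μ := by
    simp_rw [hpt]
    refine lintegral_iInf (fun k => measurable_infProd fun i =>
      measurable_const.sub ((Q k).measurable.comp (hX.measurable i))) ?_ ?_
    · intro k l hkl ω
      exact iInf_mono fun n => Finset.prod_le_prod' fun i _ => tsub_le_tsub_left (hmono _ hkl) _
    · rw [hfin]
      exact ne_top_of_le_ne_top ENNReal.one_ne_top (expNeg_le_one _)
  rw [hL]
  simp_rw [hfin]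
  refine tendsto_nhds_unique (tendsto_atTop_iInf fun k l hkl => ?_) hR
  exact expNeg_antitone (lintegral_mono fun x => hmono x hkl)

end

section

/-! ### Distances from the user and the thinned intensities -/

/-- The standing assumptions on the network parameters. -/
structure Params.Valid (p : Params) : Prop where
  lam_pos : 0 < p.lam
  h_pos : 0 < p.h
  P_pos : 0 < p.P
  N0_nonneg : 0 ≤ p.N0
  AL_pos : 0 < p.AL
  ANL_pos : 0 < p.ANL
  aL_pos : 0 < p.aL
  aNL_pos : 0 < p.aNL
  measurable_prL : Measurable p.prL
  prL_mem : ∀ r, p.h ≤ r → p.prL r ∈ Icc (0 : ℝ) 1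

variable {p : Params}

lemma le_dist3 (p : Params) (y x : Plane) : p.h ≤ dist3 p y x :=
  Real.le_sqrt_of_sq_le (by nlinarith [sq_nonneg (dist x y)])

lemma measurable_dist3 (y : Plane) : Measurable (dist3 p y) := by
  unfold dist3
  fun_prop

lemma measurable_linkProb (hp : p.Valid) (t : Bool) : Measurable (linkProb p t) := by
  have := hp.measurable_prL
  cases t
  · exact measurable_const.sub this
  · exact this

lemma linkProb_nonneg (hp : p.Valid) (t : Bool) {r : ℝ} (hr : p.h ≤ r) : 0 ≤ linkProb p t r := by
  have := hp.prL_mem r hr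
  cases t <;> simp [linkProb, this.1, this.2]

lemma linkProb_le_one (hp : p.Valid) (t : Bool) {r : ℝ} (hr : p.h ≤ r) : linkProb p t r ≤ 1 := by
  have := hp.prL_mem r hr
  cases t <;> simp [linkProb, this.1, this.2]

/-- Density at distance `r` of the intensity of the links of type `t`. -/
noncomputable def rate (p : Params) (t : Bool) (r : ℝ) : ℝ :=
  linkProb p t r * (2 * Real.pi * r * p.lam)

/-- Intensity measure of the lengths of the links of type `t`. -/
noncomputable def typeIntensity (p : Params) (t : Bool) : Measure ℝ :=
  (volume.restrict (Ici p.h)).withDensity fun r => ENNReal.ofReal (rate p t r)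

lemma measurable_rate (hp : p.Valid) (t : Bool) : Measurable (rate p t) := by
  have := measurable_linkProb hp t
  unfold rate
  fun_prop

lemma shell_nonneg (hp : p.Valid) {r : ℝ} (hr : p.h ≤ r) : 0 ≤ 2 * Real.pi * r * p.lam := by
  have := hp.h_pos.le.trans hr
  have := hp.lam_pos
  positivity

lemma rate_nonneg (hp : p.Valid) (t : Bool) {r : ℝ} (hr : p.h ≤ r) : 0 ≤ rate p t r :=
  mul_nonneg (linkProb_nonneg hp t hr) (shell_nonneg hp hr)

lemma rate_le (hp : p.Valid) (t : Bool) {r b : ℝ} (hr : p.h ≤ r) (hb : r ≤ b) :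
    rate p t r ≤ 2 * Real.pi * b * p.lam := by
  refine (mul_le_of_le_one_left (shell_nonneg hp hr) (linkProb_le_one hp t hr)).trans ?_
  have := hp.lam_pos
  gcongr

lemma volume_preimage_dist3_Iic (hp : p.Valid) (y : Plane) {a : ℝ} (ha : p.h ≤ a) :
    volume (dist3 p y ⁻¹' Iic a) = ENNReal.ofReal (Real.pi * (a ^ 2 - p.h ^ 2)) := by
  have hh := hp.h_pos
  have h0 : 0 ≤ a ^ 2 - p.h ^ 2 := by nlinarith
  have h1 : dist3 p y ⁻¹' Iic a = Metric.closedBall y (Real.sqrt (a ^ 2 - p.h ^ 2)) := by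
    ext x
    rw [mem_preimage, mem_Iic, Metric.mem_closedBall, dist3, Real.sqrt_le_left (by linarith),
      Real.le_sqrt dist_nonneg h0]
    constructor <;> intro <;> linarith
  rw [h1, EuclideanSpace.volume_closedBall, ← ENNReal.ofReal_pow (Real.sqrt_nonneg _),
    Fintype.card_fin, Real.sq_sqrt h0, Real.sq_sqrt Real.pi_pos.le, mul_comm,
    ← ENNReal.ofReal_mul (by positivity)]
  norm_num

lemma lintegral_shell (hp : p.Valid) {a b : ℝ} (ha : p.h ≤ a) (hab : a ≤ b) :
    ∫⁻ r in Ioc a b, ENNReal.ofReal (2 * Real.pi * r * p.lam) =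
      ENNReal.ofReal (p.lam * (Real.pi * (b ^ 2 - a ^ 2))) := by
  rw [← ofReal_integral_eq_lintegral_ofReal]
  · rw [← intervalIntegral.integral_of_le hab]
    have : ∀ r : ℝ, 2 * Real.pi * r * p.lam = (2 * Real.pi * p.lam) * r := fun r => by ring
    simp_rw [this]
    rw [intervalIntegral.integral_const_mul, integral_id]
    congr 1
    ring
  · exact (Continuous.integrableOn_Icc (by fun_prop)).mono_set Ioc_subset_Icc_self
  · filter_upwards [ae_restrict_mem measurableSet_Ioc] with r hr
    exact shell_nonneg hp (ha.trans hr.1.le)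

/-- The 3D distances of the UAVs have the intensity `2πλr dr` on `[h, ∞)`. -/
lemma map_dist3_volume (hp : p.Valid) (y : Plane) :
    (ENNReal.ofReal p.lam • (volume : Measure Plane)).map (dist3 p y) =
      (volume.restrict (Ici p.h)).withDensity
        fun r => ENNReal.ofReal (2 * Real.pi * r * p.lam) := by
  symm
  have hlam := hp.lam_pos
  -- It suffices to compare the two measures on intervals: both give differences of disc areas.
  have key : ∀ a b, a < b → ((volume.restrict (Ici p.h)).withDensity
        fun r => ENNReal.ofReal (2 * Real.pi * r * p.lam)) (Ioc a b) =
      ENNReal.ofReal (p.lam * (Real.pi * (max b p.h ^ 2 - max a p.h ^ 2))) := fun a b hab => by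
    rw [withDensity_apply _ measurableSet_Ioc, Measure.restrict_restrict measurableSet_Ioc]
    have h1 : (Ioc a b ∩ Ici p.h : Set ℝ) =ᵐ[volume] Ioc (max a p.h) (max b p.h) := by
      have h2 : (Ioc a b ∩ Ici p.h : Set ℝ) =ᵐ[volume] (Ioc a b ∩ Ioi p.h : Set ℝ) :=
        (ae_eq_refl _).inter Ioi_ae_eq_Ici.symm
      have h3 : (Ioc a b ∩ Ioi p.h : Set ℝ) = Ioc (max a p.h) (max b p.h) := by
        ext x
        simp only [mem_inter_iff, mem_Ioc, mem_Ioi, max_lt_iff, le_max_iff]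
        grind
      rwa [h3] at h2
    rw [Measure.restrict_congr_set h1, lintegral_shell hp (le_max_right _ _)
      (max_le_max_right _ hab.le)]
  refine Measure.ext_of_Ioc' _ _ (fun a b hab => by rw [key a b hab]; exact ENNReal.ofReal_ne_top)
    fun a b hab => ?_
  rw [key a b hab, Measure.map_apply (measurable_dist3 y) measurableSet_Ioc, Measure.smul_apply,
    smul_eq_mul, ENNReal.ofReal_mul hlam.le]
  congr 1
  rcases lt_or_ge a p.h with ha | ha
  · have h3 : dist3 p y ⁻¹' Ioc a b = dist3 p y ⁻¹' Iic b := by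
      ext x
      exact ⟨fun h => h.2, fun h => ⟨ha.trans_le (le_dist3 p y x), h⟩⟩
    rw [h3, max_eq_right ha.le]
    rcases lt_or_ge b p.h with hb | hb
    · have h4 : dist3 p y ⁻¹' Iic b = ∅ :=
        eq_empty_of_forall_notMem fun x hx => (hb.trans_le (le_dist3 p y x)).not_ge hx
      simp [h4, max_eq_right hb.le]
    · rw [max_eq_left hb, volume_preimage_dist3_Iic hp y hb]
  · have hb := ha.trans hab.le
    rw [max_eq_left ha, max_eq_left hb, ← Iic_sdiff_Iic, preimage_sdiff,
      measure_sdiff (preimage_mono (Iic_subset_Iic.2 hab.le))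
      (measurable_dist3 y measurableSet_Iic).nullMeasurableSet
      (by rw [volume_preimage_dist3_Iic hp y ha]; exact ENNReal.ofReal_ne_top),
      volume_preimage_dist3_Iic hp y hb, volume_preimage_dist3_Iic hp y ha, ← ENNReal.ofReal_sub]
    · congr 1
      ring
    · have := hp.h_pos
      exact mul_nonneg Real.pi_pos.le (by nlinarith)

variable {Ω : Type*} [MeasurableSpace Ω] {X : ℕ → Ω → Plane} {los : ℕ → Ω → Bool}
  {g : ℕ → Ω → ℝ} {y : Plane} {μ : Measure Ω}

/-! ### Marking: void probabilities of the LoS and NLoS links -/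

lemma measurableSet_forall_lt_notMem (hnet : IsNetwork p X los g y μ) {A : Bool → Set ℝ}
    (hA : ∀ t, MeasurableSet (A t)) (n : ℕ) :
    MeasurableSet {ω | ∀ i < n, dist3 p y (X i ω) ∉ A (los i ω)} := by
  have h1 : ∀ i, MeasurableSet {ω | dist3 p y (X i ω) ∉ A (los i ω)} := fun i => by
    have : {ω | dist3 p y (X i ω) ∉ A (los i ω)} =
        ⋃ t, ({ω | los i ω = t} ∩ {ω | dist3 p y (X i ω) ∉ A t}) := by
      ext ω
      simp
    rw [this]
    exact MeasurableSet.iUnion fun t =>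
      (hnet.los_measurable i (measurableSet_singleton t)).inter
        (((measurable_dist3 y).comp (hnet.poisson.measurable i)) (hA t).compl)
  simp only [ofPred_forall]
  exact MeasurableSet.iInter fun i => MeasurableSet.iInter fun _ => h1 i

/-- Probability that the first `n` links avoid a set of types and lengths: the types are integrated
out given the positions. -/
lemma measure_forall_lt_notMem (hp : p.Valid) (hnet : IsNetwork p X los g y μ)
    {A : Bool → Set ℝ} (hA : ∀ t, MeasurableSet (A t)) (n : ℕ) :
    μ {ω | ∀ i < n, dist3 p y (X i ω) ∉ A (los i ω)} =
      ∫⁻ ω, ∏ i ∈ Finset.range n, ∑ t, (A t)ᶜ.indicator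
        (fun r => ENNReal.ofReal (linkProb p t r)) (dist3 p y (X i ω)) ∂μ := by
  classical
  have hX := hnet.poisson.measurable
  have hd : ∀ i, Measurable fun ω => dist3 p y (X i ω) := fun i => (measurable_dist3 y).comp (hX i)
  have hφ : ∀ t, Measurable ((A t)ᶜ.indicator fun r => ENNReal.ofReal (linkProb p t r)) :=
    fun t => (measurable_linkProb hp t).ennreal_ofReal.indicator (hA t).compl
  simp_rw [Finset.prod_range, Finset.prod_univ_sum, Fintype.piFinset_univ]
  rw [lintegral_finsetSum (f := fun (ℓ : Fin n → Bool) ω => ∏ i, (A (ℓ i))ᶜ.indicator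
      (fun r => ENNReal.ofReal (linkProb p (ℓ i) r)) (dist3 p y (X i ω))) Finset.univ fun ℓ _ =>
    Finset.measurable_fun_prod _ fun i _ => (hφ (ℓ i)).comp (hd i)]
  have hpart : {ω | ∀ i < n, dist3 p y (X i ω) ∉ A (los i ω)} =
      ⋃ ℓ ∈ (Finset.univ : Finset (Fin n → Bool)),
        {ω | (∀ i < n, dist3 p y (X i ω) ∉ A (los i ω)) ∧ (fun i : Fin n => los i ω) = ℓ} := by
    ext ω
    simp
  have hmeas : ∀ ℓ : Fin n → Bool, MeasurableSet
      {ω | (∀ i < n, dist3 p y (X i ω) ∉ A (los i ω)) ∧ (fun i : Fin n => los i ω) = ℓ} :=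
    fun ℓ => by
    have h2 : Measurable fun ω => fun i : Fin n => los i ω :=
      measurable_pi_lambda _ fun i => hnet.los_measurable i
    exact (measurableSet_forall_lt_notMem hnet hA n).inter (h2 (measurableSet_singleton ℓ))
  rw [hpart, measure_biUnion_finset _ fun ℓ _ => hmeas ℓ]
  · refine Finset.sum_congr rfl fun ℓ _ => ?_
    set ℓ' : ℕ → Bool := fun i => if h : i < n then ℓ ⟨i, h⟩ else true with hℓ'
    have hl : ∀ i : Fin n, ℓ' i = ℓ i := fun i => by simp [hℓ']
    set D : Set (ℕ → Plane) := {x | ∀ i < n, dist3 p y (x i) ∉ A (ℓ' i)} with hD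
    have hDm : MeasurableSet D := by
      simp only [hD, ofPred_forall]
      exact MeasurableSet.iInter fun i => MeasurableSet.iInter fun _ =>
        ((measurable_dist3 y).comp (measurable_pi_apply i)) (hA _).compl
    have h1 : {ω | (∀ i < n, dist3 p y (X i ω) ∉ A (los i ω)) ∧ (fun i : Fin n => los i ω) = ℓ} =
        {ω | (fun i => X i ω) ∈ D} ∩ {ω | ∀ i ∈ Finset.range n, los i ω = ℓ' i} := by
      ext ω
      simp only [mem_ofPred_eq, mem_inter_iff, hD, Finset.mem_range]
      have h2 : (fun i : Fin n => los i ω) = ℓ ↔ ∀ i < n, los i ω = ℓ' i := by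
        rw [funext_iff, Fin.forall_iff]
        refine forall₂_congr fun i hi => ?_
        rw [← hl ⟨i, hi⟩]
      rw [h2]
      constructor
      · exact fun h => ⟨fun i hi => h.2 i hi ▸ h.1 i hi, h.2⟩
      · exact fun h => ⟨fun i hi => (h.2 i hi).symm ▸ h.1 i hi, h.2⟩
    rw [h1, hnet.los_law _ ℓ' D hDm, ← lintegral_indicator
      (show MeasurableSet {ω | (fun i => X i ω) ∈ D} from measurable_pi_lambda _ hX hDm)]
    refine lintegral_congr fun ω => ?_
    by_cases hω : (fun i => X i ω) ∈ D
    · rw [indicator_of_mem (show ω ∈ {ω | (fun i => X i ω) ∈ D} from hω), Finset.prod_range]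
      simp only [hl]
      refine Finset.prod_congr rfl fun i _ => ?_
      rw [indicator_of_mem]
      exact hl i ▸ hω i i.2
    · rw [indicator_of_notMem (show ω ∉ {ω | (fun i => X i ω) ∈ D} from hω)]
      simp only [hD, mem_ofPred_eq, not_forall, not_not] at hω
      obtain ⟨i, hi, hiA⟩ := hω
      symm
      refine Finset.prod_eq_zero (Finset.mem_univ ⟨i, hi⟩) (indicator_of_notMem ?_ _)
      rw [notMem_compl_iff, ← hl ⟨i, hi⟩]
      exact hiA
  · intro ℓ _ ℓ' _ hne
    refine Set.disjoint_left.2 fun ω h h' => hne (h.2.symm.trans h'.2)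

/-- **Void probabilities** of the marked process: no link of any type `t` has its length in `A t`.
This is the generating functional at the probability that a UAV at a given place yields a link of
the forbidden kind. -/
theorem measure_forall_notMem [IsProbabilityMeasure μ] (hp : p.Valid)
    (hnet : IsNetwork p X los g y μ) {A : Bool → Set ℝ} (hA : ∀ t, MeasurableSet (A t)) :
    μ {ω | ∀ i, dist3 p y (X i ω) ∉ A (los i ω)} = expNeg (∑ t, typeIntensity p t (A t)) := by
  have hX := hnet.poisson.measurable
  set φ : Bool → ℝ → ℝ≥0∞ := fun t r => ENNReal.ofReal (linkProb p t r) with hφ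
  have hφm : ∀ t, Measurable (φ t) := fun t => (measurable_linkProb hp t).ennreal_ofReal
  set q : ℝ → ℝ≥0∞ := fun r => ∑ t, (A t).indicator (φ t) r with hq
  have hqm : Measurable q := Finset.measurable_fun_sum _ fun t _ => (hφm t).indicator (hA t)
  have hsum : ∀ r, p.h ≤ r → q r + ∑ t, (A t)ᶜ.indicator (φ t) r = 1 := fun r hr => by
    rw [hq, ← Finset.sum_add_distrib]
    have : ∀ t, (A t).indicator (φ t) r + (A t)ᶜ.indicator (φ t) r = φ t r := fun t =>
      indicator_self_add_compl_apply (A t) (φ t) r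
    rw [Finset.sum_congr rfl fun t _ => this t, Fintype.sum_bool]
    simp only [hφ]
    rw [← ENNReal.ofReal_add (linkProb_nonneg hp _ hr) (linkProb_nonneg hp _ hr)]
    simp [linkProb]
  have hq1 : ∀ x, q (dist3 p y x) ≤ 1 := fun x =>
    (hsum _ (le_dist3 p y x)).symm ▸ le_self_add
  have hc : ∀ x, ∑ t, (A t)ᶜ.indicator (φ t) (dist3 p y x) = 1 - q (dist3 p y x) := fun x =>
    ENNReal.eq_sub_of_add_eq (ne_top_of_le_ne_top ENNReal.one_ne_top (hq1 x))
      (by rw [add_comm]; exact hsum _ (le_dist3 p y x))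
  have : SigmaFinite (ENNReal.ofReal p.lam • (volume : Measure Plane)) :=
    inferInstanceAs (SigmaFinite (p.lam.toNNReal • (volume : Measure Plane)))
  have hpgf := lintegral_infProd_one_sub hnet.poisson (hqm.comp (measurable_dist3 y)) hq1
  have hR : ∫⁻ x, (q ∘ dist3 p y) x ∂(ENNReal.ofReal p.lam • (volume : Measure Plane)) =
      ∑ t, typeIntensity p t (A t) := by
    simp only [Function.comp_apply]
    rw [← lintegral_map hqm (measurable_dist3 y), map_dist3_volume hp y,
      lintegral_withDensity_eq_lintegral_mul _ (by fun_prop) hqm]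
    simp only [hq, Pi.mul_apply, Finset.mul_sum]
    rw [lintegral_finsetSum _ fun t _ => by
      exact Measurable.mul (by fun_prop) ((hφm t).indicator (hA t))]
    refine Finset.sum_congr rfl fun t _ => ?_
    rw [typeIntensity, withDensity_apply _ (hA t), ← lintegral_indicator (hA t)]
    refine setLIntegral_congr_fun measurableSet_Ici fun r hr => ?_
    by_cases hrA : r ∈ A t
    · simp only [indicator_of_mem hrA, hφ, rate]
      rw [ENNReal.ofReal_mul (linkProb_nonneg hp t hr), mul_comm]
    · simp only [indicator_of_notMem hrA, mul_zero]
  rw [← hR, ← hpgf]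
  have hev : {ω | ∀ i, dist3 p y (X i ω) ∉ A (los i ω)} =
      ⋂ n, {ω | ∀ i < n, dist3 p y (X i ω) ∉ A (los i ω)} := by
    ext ω
    simp only [mem_ofPred_eq, mem_iInter]
    exact ⟨fun h n i _ => h i, fun h i => h (i + 1) i i.lt_succ_self⟩
  refine tendsto_nhds_unique (hev ▸ tendsto_measure_iInter_atTop
    (fun n => (measurableSet_forall_lt_notMem hnet hA n).nullMeasurableSet)
    (fun m n hmn ω h i hi => h i (hi.trans_le hmn)) ⟨0, measure_ne_top _ _⟩) ?_
  have hterm : ∀ n, μ {ω | ∀ i < n, dist3 p y (X i ω) ∉ A (los i ω)} =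
      ∫⁻ ω, ∏ i ∈ Finset.range n, (1 - (q ∘ dist3 p y) (X i ω)) ∂μ := fun n => by
    rw [measure_forall_lt_notMem hp hnet hA n]
    exact lintegral_congr fun ω => Finset.prod_congr rfl fun i _ => hc _
  simp only [Function.comp_def] at hterm ⊢
  simp_rw [hterm]
  refine tendsto_lintegral_of_dominated_convergence (fun _ => 1) (fun n => ?_) (fun n => ?_) ?_ ?_
  · exact Finset.measurable_fun_prod _ fun i _ =>
      measurable_const.sub (hqm.comp ((measurable_dist3 y).comp (hX i)))
  · exact ae_of_all _ fun ω => Finset.prod_le_one' fun i _ => tsub_le_self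
  · simp
  · exact ae_of_all _ fun ω => tendsto_infProd fun i => tsub_le_self

end

section

/-! ### Almost surely the UAVs are locally finite and have distinct distances -/

section Distinct

variable {Ω E : Type*} [MeasurableSpace Ω] [MeasurableSpace E] {X : ℕ → Ω → E} {ν : Measure E}
  {μ : Measure Ω}

/-- For a Poisson variable, `P(N ≥ 2) = 1 - exp (-m) (1 + m) ≤ 1 - (1 - m) (1 + m)`. -/
lemma measure_two_le_count_le (hX : IsPoissonProcess X ν μ) [IsProbabilityMeasure μ] {B : Set E}
    (hB : MeasurableSet B) (hν : ν B ≠ ∞) :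
    μ {ω | 2 ≤ count (fun i => X i ω) B} ≤ ν B ^ 2 := by
  have hm := measurable_count hX.measurable hB
  set m : ℝ≥0 := (ν B).toNNReal with hmdef
  have h0 := hX.count_law B hB hν 0
  have h1 := hX.count_law B hB hν 1
  rw [poissonMeasure_singleton, ← hmdef] at h0 h1
  have hm0 : MeasurableSet {ω | count (fun i => X i ω) B = ((0 : ℕ) : ℕ∞)} :=
    hm (measurableSet_singleton _)
  have hm1 : MeasurableSet {ω | count (fun i => X i ω) B = ((1 : ℕ) : ℕ∞)} :=
    hm (measurableSet_singleton _)
  have hset : {ω | 2 ≤ count (fun i => X i ω) B} =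
      ({ω | count (fun i => X i ω) B = ((0 : ℕ) : ℕ∞)} ∪
        {ω | count (fun i => X i ω) B = ((1 : ℕ) : ℕ∞)})ᶜ := by
    ext ω
    simp only [mem_ofPred_eq, mem_compl_iff, mem_union]
    cases h : count (fun i => X i ω) B with
    | top => simp
    | coe n =>
      norm_cast
      omega
  have hdisj : Disjoint {ω | count (fun i => X i ω) B = ((0 : ℕ) : ℕ∞)}
      {ω | count (fun i => X i ω) B = ((1 : ℕ) : ℕ∞)} :=
    Set.disjoint_left.2 fun ω h h' => by
      have := (Eq.symm h).trans h'
      simp at this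
  have hb : ν B = ENNReal.ofReal m := by
    rw [ENNReal.ofReal_coe_nnreal, hmdef, ENNReal.coe_toNNReal hν]
  rw [hset, prob_compl_eq_one_sub (hm0.union hm1), measure_union hdisj hm1, h0, h1,
    ← ENNReal.ofReal_add (by positivity) (by positivity), ← ENNReal.ofReal_one,
    ← ENNReal.ofReal_sub _ (by positivity), hb, ← ENNReal.ofReal_pow m.coe_nonneg]
  refine ENNReal.ofReal_le_ofReal ?_
  have h2 := Real.add_one_le_exp (-(m : ℝ))
  have h3 := m.coe_nonneg
  simp only [pow_zero, pow_one, Nat.factorial_zero, Nat.factorial_one, Nat.cast_one, div_one,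
    mul_one]
  nlinarith

end Distinct

variable {p : Params} {Ω : Type*} {X : ℕ → Ω → Plane} {los : ℕ → Ω → Bool} {y : Plane}

section Random

variable [MeasurableSpace Ω] {g : ℕ → Ω → ℝ} {μ : Measure Ω}

lemma intensity_preimage_dist3_Ico_le (hp : p.Valid) (y : Plane) {a b R : ℝ} (hb : b ≤ R) :
    (ENNReal.ofReal p.lam • (volume : Measure Plane)) (dist3 p y ⁻¹' Ico a b) ≤
      ENNReal.ofReal (2 * Real.pi * R * p.lam) * ENNReal.ofReal (b - a) := by
  have hlam := hp.lam_pos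
  rw [← Measure.map_apply (measurable_dist3 y) measurableSet_Ico, map_dist3_volume hp y,
    withDensity_apply _ measurableSet_Ico, Measure.restrict_restrict measurableSet_Ico]
  calc ∫⁻ r in Ico a b ∩ Ici p.h, ENNReal.ofReal (2 * Real.pi * r * p.lam)
      ≤ ∫⁻ _ in Ico a b ∩ Ici p.h, ENNReal.ofReal (2 * Real.pi * R * p.lam) := by
        refine setLIntegral_mono measurable_const fun r hr => ENNReal.ofReal_le_ofReal ?_
        have := hr.1.2.le.trans hb
        gcongr
    _ ≤ _ := by
        rw [setLIntegral_const]
        gcongr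
        exact (measure_mono inter_subset_left).trans (by rw [Real.volume_Ico])

/-- Within a bounded distance, a fine partition into shells has at most one UAV in each shell, up to
an event whose probability is of the order of the mesh. -/
lemma measure_exists_dist3_eq_lt (hp : p.Valid) (hnet : IsNetwork p X los g y μ)
    [IsProbabilityMeasure μ] (K : ℕ) :
    μ {ω | ∃ i j, i ≠ j ∧ dist3 p y (X i ω) = dist3 p y (X j ω) ∧
      dist3 p y (X i ω) < p.h + K} = 0 := by
  set C : ℝ := 2 * Real.pi * (p.h + K) * p.lam with hC
  have hC0 : 0 ≤ C := by
    have := hp.h_pos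
    have := hp.lam_pos
    positivity
  have hbound : ∀ n : ℕ, μ {ω | ∃ i j, i ≠ j ∧ dist3 p y (X i ω) = dist3 p y (X j ω) ∧
      dist3 p y (X i ω) < p.h + K} ≤ ENNReal.ofReal (K * C ^ 2 * (1 / ((n : ℝ) + 1))) := fun n => by
    have hn : (0 : ℝ) < n + 1 := by positivity
    set B : ℕ → Set Plane := fun k =>
      dist3 p y ⁻¹' Ico (p.h + k / ((n : ℝ) + 1)) (p.h + (k + 1) / ((n : ℝ) + 1)) with hB
    have hBm : ∀ k, MeasurableSet (B k) := fun k => measurable_dist3 y measurableSet_Ico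
    have hBν : ∀ k < (n + 1) * K, (ENNReal.ofReal p.lam • (volume : Measure Plane)) (B k) ≤
        ENNReal.ofReal (C * (1 / ((n : ℝ) + 1))) := fun k hk => by
      have hk' : ((k : ℝ) + 1) ≤ (n + 1) * K := by exact_mod_cast hk
      refine (intensity_preimage_dist3_Ico_le hp y (R := p.h + K) ?_).trans (le_of_eq ?_)
      · gcongr
        rw [div_le_iff₀ hn]
        linarith
      · rw [← ENNReal.ofReal_mul hC0]
        congr 2
        ring
    have hsub : {ω | ∃ i j, i ≠ j ∧ dist3 p y (X i ω) = dist3 p y (X j ω) ∧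
        dist3 p y (X i ω) < p.h + K} ⊆
        ⋃ k ∈ Finset.range ((n + 1) * K), {ω | 2 ≤ count (fun i => X i ω) (B k)} := by
      rintro ω ⟨i, j, hij, hd, hlt⟩
      have h0 : 0 ≤ dist3 p y (X i ω) - p.h := sub_nonneg.2 (le_dist3 p y _)
      set k := ⌊(dist3 p y (X i ω) - p.h) * (n + 1)⌋₊ with hk
      have hk1 : (k : ℝ) ≤ (dist3 p y (X i ω) - p.h) * (n + 1) := Nat.floor_le (by positivity)
      have hk2 : (dist3 p y (X i ω) - p.h) * (n + 1) < k + 1 := Nat.lt_floor_add_one _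
      have hmem : X i ω ∈ B k := by
        refine ⟨?_, ?_⟩
        · have := (div_le_iff₀ hn).2 hk1
          linarith
        · have := (lt_div_iff₀ hn).2 hk2
          linarith
      have hmem' : X j ω ∈ B k := by
        simp only [hB, mem_preimage] at hmem ⊢
        rwa [← hd]
      simp only [mem_iUnion, Finset.mem_range, mem_ofPred_eq, exists_prop]
      refine ⟨k, ?_, ?_⟩
      · have : (k : ℝ) < (n + 1) * K := by nlinarith
        exact_mod_cast this
      · rw [← Set.encard_pair hij]
        refine Set.encard_le_encard ?_
        rintro l (rfl | rfl)
        · exact hmem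
        · exact hmem'
    calc _ ≤ μ (⋃ k ∈ Finset.range ((n + 1) * K), {ω | 2 ≤ count (fun i => X i ω) (B k)}) :=
          measure_mono hsub
      _ ≤ ∑ k ∈ Finset.range ((n + 1) * K), μ {ω | 2 ≤ count (fun i => X i ω) (B k)} :=
          measure_biUnion_finset_le _ _
      _ ≤ ∑ k ∈ Finset.range ((n + 1) * K), ENNReal.ofReal (C * (1 / ((n : ℝ) + 1))) ^ 2 := by
          refine Finset.sum_le_sum fun k hk => ?_
          have hk' := hBν k (Finset.mem_range.1 hk)
          refine (measure_two_le_count_le hnet.poisson (hBm k)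
            (ne_top_of_le_ne_top ENNReal.ofReal_ne_top hk')).trans ?_
          gcongr
      _ = ENNReal.ofReal (K * C ^ 2 * (1 / ((n : ℝ) + 1))) := by
          rw [Finset.sum_const, Finset.card_range, nsmul_eq_mul,
            ← ENNReal.ofReal_pow (by positivity), ← ENNReal.ofReal_natCast,
            ← ENNReal.ofReal_mul (by positivity)]
          congr 1
          push_cast
          field_simp
  refine le_antisymm (ge_of_tendsto' (x := atTop) ?_ hbound) zero_le
  have h := (tendsto_one_div_add_atTop_nhds_zero_nat (𝕜 := ℝ)).const_mul ((K : ℝ) * C ^ 2)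
  rw [mul_zero] at h
  simpa using ENNReal.tendsto_ofReal h

lemma ae_dist3_injective (hp : p.Valid) (hnet : IsNetwork p X los g y μ)
    [IsProbabilityMeasure μ] :
    ∀ᵐ ω ∂μ, Function.Injective fun i => dist3 p y (X i ω) := by
  have h : ∀ᵐ ω ∂μ, ∀ K : ℕ, ¬∃ i j, i ≠ j ∧ dist3 p y (X i ω) = dist3 p y (X j ω) ∧
      dist3 p y (X i ω) < p.h + K :=
    ae_all_iff.2 fun K => by
      rw [ae_iff]
      simpa only [not_not] using measure_exists_dist3_eq_lt hp hnet K
  filter_upwards [h] with ω hω i j hij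
  by_contra hne
  obtain ⟨K, hK⟩ := exists_nat_gt (dist3 p y (X i ω) - p.h)
  exact hω K ⟨i, j, hne, hij, by linarith⟩

lemma ae_finite_dist3_le (hp : p.Valid) (hnet : IsNetwork p X los g y μ)
    [IsProbabilityMeasure μ] :
    ∀ᵐ ω ∂μ, ∀ R, {i | dist3 p y (X i ω) ≤ R}.Finite := by
  have h : ∀ᵐ ω ∂μ, ∀ K : ℕ, {i | X i ω ∈ dist3 p y ⁻¹' Ico p.h K}.Finite :=
    ae_all_iff.2 fun K => ae_finite_of_ne_top hnet.poisson
      (measurable_dist3 y measurableSet_Ico)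
      (ne_top_of_le_ne_top (ENNReal.mul_ne_top ENNReal.ofReal_ne_top ENNReal.ofReal_ne_top)
        (intensity_preimage_dist3_Ico_le hp y le_rfl))
  filter_upwards [h] with ω hω R
  obtain ⟨K, hK⟩ := exists_nat_gt R
  exact (hω K).subset fun i (hi : _ ≤ R) => ⟨le_dist3 p y _, hi.trans_lt hK⟩

end Random

/-! ### Path losses and the distance of equal signal strength -/

/-- Path loss at reference distance `1` for links of type `t`. -/
noncomputable def amp (p : Params) (t : Bool) : ℝ := if t then p.AL else p.ANL

/-- Path loss exponent for links of type `t`. -/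
noncomputable def expo (p : Params) (t : Bool) : ℝ := if t then p.aL else p.aNL

lemma amp_pos (hp : p.Valid) (t : Bool) : 0 < amp p t := by
  cases t <;> simp [amp, hp.AL_pos, hp.ANL_pos]

lemma expo_pos (hp : p.Valid) (t : Bool) : 0 < expo p t := by
  cases t <;> simp [expo, hp.aL_pos, hp.aNL_pos]

lemma zeta_eq (t : Bool) (r : ℝ) : zeta p t r = amp p t * r ^ (-expo p t) := by
  cases t <;> simp [zeta, amp, expo, zetaL, zetaNL]

lemma zeta_pos (hp : p.Valid) (t : Bool) {r : ℝ} (hr : 0 < r) : 0 < zeta p t r := by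
  rw [zeta_eq]
  exact mul_pos (amp_pos hp t) (Real.rpow_pos_of_pos hr _)

lemma zeta_le_zeta_iff (hp : p.Valid) (t : Bool) {r s : ℝ} (hr : 0 < r) (hs : 0 < s) :
    zeta p t r ≤ zeta p t s ↔ s ≤ r := by
  rw [zeta_eq, zeta_eq, mul_le_mul_iff_right₀ (amp_pos hp t),
    Real.rpow_le_rpow_iff_of_neg hr hs (neg_neg_of_pos (expo_pos hp t))]

lemma measurable_zeta (t : Bool) : Measurable (zeta p t) := by
  simp only [funext (zeta_eq (p := p) t)]
  fun_prop

/-- The length at which a link of the other type is as strong as a link of type `t` and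
length `r`. -/
noncomputable def eqDist (p : Params) (t : Bool) (r : ℝ) : ℝ :=
  (zeta p t r / amp p !t) ^ (-(expo p !t)⁻¹)

lemma measurable_eqDist (t : Bool) : Measurable (eqDist p t) := by
  have := measurable_zeta (p := p) t
  unfold eqDist
  fun_prop

lemma eqDist_pos (hp : p.Valid) (t : Bool) {r : ℝ} (hr : 0 < r) : 0 < eqDist p t r :=
  Real.rpow_pos_of_pos (div_pos (zeta_pos hp t hr) (amp_pos hp _)) _

lemma zeta_eqDist (hp : p.Valid) (t : Bool) {r : ℝ} (hr : 0 < r) :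
    zeta p (!t) (eqDist p t r) = zeta p t r := by
  have h := (div_pos (zeta_pos hp t hr) (amp_pos hp !t)).le
  rw [zeta_eq (!t), eqDist, ← Real.rpow_mul h, neg_mul_neg,
    inv_mul_cancel₀ (expo_pos hp !t).ne', Real.rpow_one, mul_div_cancel₀ _ (amp_pos hp !t).ne']

lemma eqDist_le_iff (hp : p.Valid) (t : Bool) {r s : ℝ} (hr : 0 < r) (hs : 0 < s) :
    eqDist p t r ≤ s ↔ zeta p (!t) s ≤ zeta p t r := by
  rw [← zeta_eqDist hp t hr, zeta_le_zeta_iff hp _ hs (eqDist_pos hp t hr)]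

lemma le_eqDist_iff (hp : p.Valid) (t : Bool) {r s : ℝ} (hr : 0 < r) (hs : 0 < s) :
    s ≤ eqDist p t r ↔ zeta p t r ≤ zeta p (!t) s := by
  rw [← zeta_eqDist hp t hr, zeta_le_zeta_iff hp _ (eqDist_pos hp t hr) hs]

lemma eq_eqDist (hp : p.Valid) (t : Bool) {r s : ℝ} (hr : 0 < r) (hs : 0 < s)
    (h : zeta p (!t) s = zeta p t r) : s = eqDist p t r :=
  le_antisymm ((le_eqDist_iff hp t hr hs).2 h.ge) ((eqDist_le_iff hp t hr hs).2 h.le)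

/-! ### The serving link in terms of the nearest links of either type -/

lemma dist3_pos (hp : p.Valid) (y x : Plane) : 0 < dist3 p y x :=
  hp.h_pos.trans_le (le_dist3 p y x)

/-- Length of the shortest link of type `t`; it is `∞` if there is none. -/
noncomputable def nearest (p : Params) (X : ℕ → Ω → Plane) (los : ℕ → Ω → Bool) (y : Plane)
    (t : Bool) (ω : Ω) : ℝ≥0∞ :=
  ⨅ i, if los i ω = t then ENNReal.ofReal (dist3 p y (X i ω)) else ⊤

lemma le_nearest_iff {t : Bool} {ω : Ω} {a : ℝ≥0∞} :
    a ≤ nearest p X los y t ω ↔ ∀ i, los i ω = t → a ≤ ENNReal.ofReal (dist3 p y (X i ω)) := by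
  rw [nearest, le_iInf_iff]
  refine forall_congr' fun i => ?_
  split_ifs with h <;> simp [h]

lemma isStrongest_iff (hp : p.Valid) {ω : Ω} {i : ℕ} : IsStrongest p X los y ω i ↔
    ∀ j, zeta p (los j ω) (dist3 p y (X j ω)) ≤ zeta p (los i ω) (dist3 p y (X i ω)) :=
  forall_congr' fun _ => mul_le_mul_iff_right₀ hp.P_pos

/-- If UAVs do not accumulate, only finitely many are at least as strong as UAV `0`, and one of
these is the strongest. -/
lemma exists_isStrongest (hp : p.Valid) {ω : Ω} (hfin : ∀ R, {i | dist3 p y (X i ω) ≤ R}.Finite) :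
    ∃ i, IsStrongest p X los y ω i := by
  have hd := fun i => dist3_pos hp y (X i ω)
  set b : ℕ → ℝ := fun i => zeta p (los i ω) (dist3 p y (X i ω)) with hb
  have hS : {j | b 0 ≤ b j}.Finite := by
    refine (hfin (max (dist3 p y (X 0 ω)) (eqDist p (los 0 ω) (dist3 p y (X 0 ω))))).subset
      fun j (hj : b 0 ≤ b j) => ?_
    simp only [hb] at hj
    rw [mem_ofPred_eq, le_max_iff]
    rcases eq_or_ne (los j ω) (los 0 ω) with h | h
    · rw [h, zeta_le_zeta_iff hp _ (hd 0) (hd j)] at hj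
      exact Or.inl hj
    · rw [Bool.eq_not_of_ne h] at hj
      exact Or.inr ((le_eqDist_iff hp _ (hd 0) (hd j)).2 hj)
  obtain ⟨i, hi, hmax⟩ := hS.exists_maximalFor b _ ⟨0, le_refl (b 0)⟩
  refine ⟨i, (isStrongest_iff hp).2 fun j => ?_⟩
  rcases le_total (b i) (b j) with h | h
  · exact hmax (show b 0 ≤ b j from le_trans hi h) h
  · exact h

lemma nearest_eq_of_isStrongest (hp : p.Valid) {ω : Ω} {i : ℕ}
    (hi : IsStrongest p X los y ω i) :
    nearest p X los y (los i ω) ω = ENNReal.ofReal (dist3 p y (X i ω)) := by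
  refine le_antisymm ((iInf_le _ i).trans (by simp)) (le_nearest_iff.2 fun j hj => ?_)
  have h := (isStrongest_iff hp).1 hi j
  rw [hj, zeta_le_zeta_iff hp _ (dist3_pos hp y _) (dist3_pos hp y _)] at h
  exact ENNReal.ofReal_le_ofReal h

lemma eqDist_le_nearest_of_isStrongest (hp : p.Valid) {ω : Ω} {i : ℕ}
    (hi : IsStrongest p X los y ω i) :
    ENNReal.ofReal (eqDist p (los i ω) (dist3 p y (X i ω))) ≤
      nearest p X los y (!los i ω) ω := by
  refine le_nearest_iff.2 fun j hj => ENNReal.ofReal_le_ofReal ?_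
  have h := (isStrongest_iff hp).1 hi j
  rw [hj] at h
  exact (eqDist_le_iff hp _ (dist3_pos hp y _) (dist3_pos hp y _)).2 h

/-- The nearest links of the two types are equally strong. -/
def NearestTie (p : Params) (X : ℕ → Ω → Plane) (los : ℕ → Ω → Bool) (y : Plane)
    (t : Bool) (ω : Ω) : Prop :=
  nearest p X los y t ω ≠ ∞ ∧
    nearest p X los y (!t) ω = ENNReal.ofReal (eqDist p t (nearest p X los y t ω).toReal)

lemma existsUnique_isStrongest (hp : p.Valid) {ω : Ω}
    (hfin : ∀ R, {i | dist3 p y (X i ω) ≤ R}.Finite)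
    (hinj : Function.Injective fun i => dist3 p y (X i ω))
    (htie : ∀ t, ¬NearestTie p X los y t ω) : ∃! i, IsStrongest p X los y ω i := by
  obtain ⟨i, hi⟩ := exists_isStrongest (los := los) hp hfin
  refine ⟨i, hi, fun j hj => hinj ?_⟩
  have hdi := dist3_pos hp y (X i ω)
  have hdj := dist3_pos hp y (X j ω)
  have hni := nearest_eq_of_isStrongest hp hi
  have hnj := nearest_eq_of_isStrongest hp hj
  rcases eq_or_ne (los j ω) (los i ω) with h | h
  · rw [h, hni, ENNReal.ofReal_eq_ofReal_iff hdi.le hdj.le] at hnj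
    exact hnj.symm
  · have hji := Bool.eq_not_of_ne h
    refine (htie (los i ω) ⟨by rw [hni]; exact ENNReal.ofReal_ne_top, ?_⟩).elim
    rw [← hji, hnj, hni, ENNReal.toReal_ofReal hdi.le]
    congr 1
    refine eq_eqDist hp _ hdi hdj ?_
    rw [← hji]
    exact le_antisymm ((isStrongest_iff hp).1 hi j) ((isStrongest_iff hp).1 hj i)

/-- Outside ties, the serving link is of type `t` with length in `B` if and only if so is the
nearest link of type `t` and the nearest link of the other type is not stronger. -/
lemma serving_mem_iff (hp : p.Valid) {ω : Ω}
    (hfin : ∀ R, {i | dist3 p y (X i ω) ≤ R}.Finite)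
    (htie : ∀ t, ¬NearestTie p X los y t ω) (t : Bool) (B : Set ℝ) :
    ((servingLink p X los y ω).1 = t ∧ (servingLink p X los y ω).2 ∈ B) ↔
      nearest p X los y t ω ≠ ∞ ∧ (nearest p X los y t ω).toReal ∈ B ∧
      ENNReal.ofReal (eqDist p t (nearest p X los y t ω).toReal) ≤ nearest p X los y (!t) ω := by
  have hs : IsStrongest p X los y ω (serving p X los y ω) :=
    Nat.sInf_mem (exists_isStrongest (los := los) hp hfin)
  simp only [servingLink]
  set s := serving p X los y ω with hsdef
  have hd := dist3_pos hp y (X s ω)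
  have hn := nearest_eq_of_isStrongest hp hs
  have he := eqDist_le_nearest_of_isStrongest hp hs
  constructor
  · rintro ⟨rfl, hB⟩
    rw [hn, ENNReal.toReal_ofReal hd.le]
    exact ⟨ENNReal.ofReal_ne_top, hB, he⟩
  · rintro ⟨h1, h2, h3⟩
    rcases eq_or_ne (los s ω) t with h | h
    · subst h
      rw [hn, ENNReal.toReal_ofReal hd.le] at h2
      exact ⟨rfl, h2⟩
    · refine (htie t ⟨h1, ?_⟩).elim
      have hst := Bool.eq_not_of_ne h
      rw [hst] at hn he
      rw [Bool.not_not, ENNReal.ofReal_le_iff_le_toReal h1] at he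
      have hpos := (eqDist_pos hp (!t) hd).trans_le he
      rw [eqDist_le_iff hp _ hd hpos, Bool.not_not] at he
      rw [hn, ENNReal.ofReal_le_ofReal_iff hd.le, eqDist_le_iff hp _ hpos hd] at h3
      rw [hn, ← eq_eqDist hp t hpos hd (le_antisymm h3 he)]

end

section

/-! ### The joint law of the nearest links of the two types -/

variable {p : Params}

/-- Mean number of links of type `t` and length at most `r`. -/
noncomputable def cumRate (p : Params) (t : Bool) (r : ℝ) : ℝ := ∫ u in Icc p.h r, rate p t u

/-- Density of the length of the nearest link of type `t`, on the event that there is one. -/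
noncomputable def nearestDensity (p : Params) (t : Bool) (r : ℝ) : ℝ :=
  Real.exp (-cumRate p t r) * rate p t r

lemma integrableOn_rate (hp : p.Valid) (t : Bool) (b : ℝ) :
    IntegrableOn (rate p t) (Icc p.h b) := by
  refine Measure.integrableOn_of_bounded (M := 2 * Real.pi * b * p.lam)
    (by simp) (measurable_rate hp t).aestronglyMeasurable ?_
  filter_upwards [ae_restrict_mem measurableSet_Icc] with r hr
  rw [Real.norm_of_nonneg (rate_nonneg hp t hr.1)]
  exact rate_le hp t hr.1 hr.2

lemma cumRate_nonneg (hp : p.Valid) (t : Bool) (r : ℝ) : 0 ≤ cumRate p t r :=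
  setIntegral_nonneg measurableSet_Icc fun _ hu => rate_nonneg hp t hu.1

lemma cumRate_eq_zero {t : Bool} {r : ℝ} (hr : r ≤ p.h) : cumRate p t r = 0 := by
  rcases hr.lt_or_eq with hr | rfl
  · simp [cumRate, hr]
  · simp [cumRate]

lemma cumRate_max (t : Bool) (r : ℝ) : cumRate p t (max r p.h) = cumRate p t r := by
  rcases le_total r p.h with h | h
  · rw [max_eq_right h, cumRate_eq_zero le_rfl, cumRate_eq_zero h]
  · rw [max_eq_left h]

lemma cumRate_eq_intervalIntegral (t : Bool) {r : ℝ} (hr : p.h ≤ r) :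
    cumRate p t r = ∫ u in p.h..r, rate p t u := by
  rw [intervalIntegral.integral_of_le hr, cumRate, integral_Icc_eq_integral_Ioc]

lemma monotone_cumRate (hp : p.Valid) (t : Bool) : Monotone (cumRate p t) := fun _ b hab =>
  setIntegral_mono_set (integrableOn_rate hp t b)
    (by filter_upwards [ae_restrict_mem measurableSet_Icc] with u hu using rate_nonneg hp t hu.1)
    (Icc_subset_Icc_right hab).eventuallyLE

lemma cumRate_sub_le (hp : p.Valid) (t : Bool) {a b R : ℝ} (ha : p.h ≤ a) (hab : a ≤ b)
    (hb : b ≤ R) : cumRate p t b - cumRate p t a ≤ 2 * Real.pi * R * p.lam * (b - a) := by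
  have hI : ∀ c d, p.h ≤ c → c ≤ d → IntervalIntegrable (rate p t) volume c d := fun c d hc hcd =>
    (intervalIntegrable_iff_integrableOn_Icc_of_le hcd).2
      ((integrableOn_rate hp t d).mono_set (Icc_subset_Icc_left hc))
  rw [cumRate_eq_intervalIntegral t ha, cumRate_eq_intervalIntegral t (ha.trans hab),
    intervalIntegral.integral_interval_sub_left (hI _ _ le_rfl (ha.trans hab)) (hI _ _ le_rfl ha)]
  refine (intervalIntegral.integral_mono_on hab (hI _ _ ha hab) intervalIntegrable_const
    fun u hu => rate_le hp t (ha.trans hu.1) (hu.2.trans hb)).trans (le_of_eq ?_)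
  rw [intervalIntegral.integral_const, smul_eq_mul, mul_comm]

/-- `exp (-cumRate)` is Lipschitz on bounded intervals, hence the integral of its almost everywhere
derivative, although `rate` need not be continuous. -/
lemma integral_nearestDensity (hp : p.Valid) (t : Bool) {a b : ℝ} (ha : p.h ≤ a) (hab : a ≤ b) :
    ∫ r in a..b, nearestDensity p t r =
      Real.exp (-cumRate p t a) - Real.exp (-cumRate p t b) := by
  set F : ℝ → ℝ := fun r => Real.exp (-cumRate p t r) with hF
  set C : ℝ := 2 * Real.pi * b * p.lam with hC
  have hC0 : 0 ≤ C := shell_nonneg hp (ha.trans hab)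
  -- `exp (-·)` is `1`-Lipschitz on `[0, ∞)`.
  have hexp : ∀ u v : ℝ, 0 ≤ u → u ≤ v → |Real.exp (-u) - Real.exp (-v)| ≤ v - u :=
    fun u v hu huv => by
    have h1 : Real.exp (-v) ≤ Real.exp (-u) := Real.exp_le_exp.2 (by linarith)
    have h2 : Real.exp (-v) = Real.exp (-u) * Real.exp (-(v - u)) := by
      rw [← Real.exp_add]
      congr 1
      ring
    have h3 := Real.add_one_le_exp (-(v - u))
    have h4 : Real.exp (-u) ≤ 1 := Real.exp_le_one_iff.2 (by linarith)
    have h5 := Real.exp_pos (-u)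
    rw [abs_of_nonneg (by linarith), h2]
    nlinarith
  have hmono : ∀ u ∈ Icc a b, ∀ v ∈ Icc a b, u ≤ v → dist (F u) (F v) ≤ C * dist u v :=
    fun u hu v hv huv => by
    rw [Real.dist_eq, Real.dist_eq, abs_sub_comm u v, abs_of_nonneg (sub_nonneg.2 huv)]
    exact (hexp _ _ (cumRate_nonneg hp t u) (monotone_cumRate hp t huv)).trans
      (cumRate_sub_le hp t (ha.trans hu.1) huv hv.2)
  have hLip : LipschitzOnWith C.toNNReal F (uIcc a b) := by
    rw [uIcc_of_le hab]
    refine LipschitzOnWith.of_dist_le_mul fun u hu v hv => ?_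
    rw [Real.coe_toNNReal _ hC0]
    rcases le_total u v with h | h
    · exact hmono u hu v hv h
    · rw [dist_comm (F u), dist_comm u]
      exact hmono v hv u hu h
  have hFTC := hLip.absolutelyContinuousOnInterval.integral_deriv_eq_sub
  have hI : IntervalIntegrable (rate p t) volume p.h b :=
    (intervalIntegrable_iff_integrableOn_Icc_of_le (ha.trans hab)).2 (integrableOn_rate hp t b)
  have hderiv : ∀ᵐ r, r ∈ uIoc a b → deriv F r = -nearestDensity p t r := by
    filter_upwards [hI.ae_hasDerivAt_integral] with r hr hmem
    rw [uIoc_of_le hab] at hmem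
    have hrh : p.h < r := ha.trans_lt hmem.1
    have h1 := hr (by rw [uIcc_of_le (ha.trans hab)]; exact ⟨hrh.le, hmem.2⟩) p.h left_mem_uIcc
    have h2 : HasDerivAt (cumRate p t) (rate p t r) r := by
      refine h1.congr_of_eventuallyEq ?_
      filter_upwards [lt_mem_nhds hrh] with u hu
      exact cumRate_eq_intervalIntegral t hu.le
    have h3 : HasDerivAt F (Real.exp (-cumRate p t r) * -rate p t r) r := h2.neg.exp
    rw [h3.deriv, nearestDensity]
    ring
  rw [intervalIntegral.integral_congr_ae hderiv, intervalIntegral.integral_neg] at hFTC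
  simp only [hF] at hFTC
  linarith

lemma measurable_cumRate (hp : p.Valid) (t : Bool) : Measurable (cumRate p t) :=
  (monotone_cumRate hp t).measurable

lemma measurable_nearestDensity (hp : p.Valid) (t : Bool) : Measurable (nearestDensity p t) := by
  have := measurable_cumRate hp t
  have := measurable_rate hp t
  unfold nearestDensity
  fun_prop

lemma nearestDensity_nonneg (hp : p.Valid) (t : Bool) {r : ℝ} (hr : p.h ≤ r) :
    0 ≤ nearestDensity p t r := mul_nonneg (Real.exp_pos _).le (rate_nonneg hp t hr)

lemma lintegral_nearestDensity (hp : p.Valid) (t : Bool) {a b : ℝ} (ha : p.h ≤ a) (hab : a ≤ b) :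
    ∫⁻ r in Ico a b, ENNReal.ofReal (nearestDensity p t r) =
      ENNReal.ofReal (Real.exp (-cumRate p t a) - Real.exp (-cumRate p t b)) := by
  rw [← integral_nearestDensity hp t ha hab, intervalIntegral.integral_of_le hab,
    ← integral_Ico_eq_integral_Ioc, ofReal_integral_eq_lintegral_ofReal]
  · refine Integrable.mono' (g := rate p t)
      ((integrableOn_rate hp t b).mono_set
        (Ico_subset_Icc_self.trans (Icc_subset_Icc_left ha)))
      (measurable_nearestDensity hp t).aestronglyMeasurable ?_
    filter_upwards [ae_restrict_mem measurableSet_Ico] with r hr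
    have hr' := ha.trans hr.1
    rw [Real.norm_of_nonneg (nearestDensity_nonneg hp t hr')]
    exact mul_le_of_le_one_left (rate_nonneg hp t hr')
      (Real.exp_le_one_iff.2 (neg_nonpos.2 (cumRate_nonneg hp t r)))
  · filter_upwards [ae_restrict_mem measurableSet_Ico] with r hr
    exact nearestDensity_nonneg hp t (ha.trans hr.1)

lemma typeIntensity_Iio (hp : p.Valid) (t : Bool) (a : ℝ) :
    typeIntensity p t {r | ENNReal.ofReal r < ENNReal.ofReal a} =
      ENNReal.ofReal (cumRate p t a) := by
  have hm : MeasurableSet {r : ℝ | ENNReal.ofReal r < ENNReal.ofReal a} :=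
    measurableSet_lt ENNReal.measurable_ofReal measurable_const
  rw [typeIntensity, withDensity_apply _ hm, Measure.restrict_restrict hm]
  have h1 : ({r : ℝ | ENNReal.ofReal r < ENNReal.ofReal a} ∩ Ici p.h : Set ℝ) = Ico p.h a := by
    ext r
    simp only [mem_inter_iff, mem_ofPred_eq, mem_Ici, mem_Ico]
    rw [and_comm]
    refine and_congr_right fun hr => ENNReal.ofReal_lt_ofReal_iff' (p := r) |>.trans ?_
    have := hp.h_pos
    exact ⟨fun h => h.1, fun h => ⟨h, by linarith⟩⟩
  rw [h1, Measure.restrict_congr_set Ico_ae_eq_Icc, cumRate, ofReal_integral_eq_lintegral_ofReal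
    (integrableOn_rate hp t a)]
  filter_upwards [ae_restrict_mem measurableSet_Icc] with r hr using rate_nonneg hp t hr.1

variable {Ω : Type*} [MeasurableSpace Ω] {X : ℕ → Ω → Plane} {los : ℕ → Ω → Bool}
  {g : ℕ → Ω → ℝ} {y : Plane} {μ : Measure Ω}

lemma measurable_nearest (hnet : IsNetwork p X los g y μ) (t : Bool) :
    Measurable (nearest p X los y t) :=
  Measurable.iInf fun i => Measurable.ite (hnet.los_measurable i (measurableSet_singleton t))
    ((measurable_dist3 y).comp (hnet.poisson.measurable i)).ennreal_ofReal measurable_const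

lemma measure_forall_le_nearest [IsProbabilityMeasure μ] (hp : p.Valid)
    (hnet : IsNetwork p X los g y μ) (a : Bool → ℝ≥0∞) :
    μ {ω | ∀ t, a t ≤ nearest p X los y t ω} =
      ∏ t, expNeg (typeIntensity p t {r | ENNReal.ofReal r < a t}) := by
  rw [← expNeg_sum, ← measure_forall_notMem hp hnet
    (A := fun t => {r | ENNReal.ofReal r < a t})
    fun t => measurableSet_lt ENNReal.measurable_ofReal measurable_const]
  congr 1
  ext ω
  simp only [mem_ofPred_eq, le_nearest_iff, not_lt]
  exact ⟨fun h i => h _ i rfl, fun h t i hi => hi ▸ h i⟩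

lemma measure_le_nearest [IsProbabilityMeasure μ] (hp : p.Valid)
    (hnet : IsNetwork p X los g y μ) (t : Bool) (a : ℝ≥0∞) :
    μ {ω | a ≤ nearest p X los y t ω} =
      expNeg (typeIntensity p t {r | ENNReal.ofReal r < a}) := by
  have h := measure_forall_le_nearest hp hnet fun u => if u = t then a else 0
  have h1 : {ω | ∀ u, (if u = t then a else 0) ≤ nearest p X los y u ω} =
      {ω | a ≤ nearest p X los y t ω} := by
    ext ω
    simp only [mem_ofPred_eq]
    refine ⟨fun h => by simpa using h t, fun h u => ?_⟩
    split_ifs with hu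
    · exact hu ▸ h
    · exact zero_le
  rw [← h1, h, Finset.prod_eq_single t]
  · simp
  · intro u _ hu
    simp [hu]
  · simp

lemma measure_ofReal_le_nearest [IsProbabilityMeasure μ] (hp : p.Valid)
    (hnet : IsNetwork p X los g y μ) (t : Bool) (a : ℝ) :
    μ {ω | ENNReal.ofReal a ≤ nearest p X los y t ω} =
      ENNReal.ofReal (Real.exp (-cumRate p t a)) := by
  rw [measure_le_nearest hp hnet, typeIntensity_Iio hp, expNeg_ofReal (cumRate_nonneg hp t a)]

/-- The nearest LoS and the nearest NLoS link are independent: by the void probabilities,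
`P(a ≤ nearest t, b ≤ nearest (!t))` factorizes. -/
lemma indepFun_nearest [IsProbabilityMeasure μ] (hp : p.Valid)
    (hnet : IsNetwork p X los g y μ) (t : Bool) :
    IndepFun (nearest p X los y t) (nearest p X los y !t) μ := by
  have hgen : ∀ u, (inferInstance : MeasurableSpace ℝ≥0∞).comap (nearest p X los y u) =
      MeasurableSpace.generateFrom (preimage (nearest p X los y u) '' range Ici) := fun u => by
    rw [← MeasurableSpace.comap_generateFrom, ← borel_eq_generateFrom_Ici,
      ← BorelSpace.measurable_eq]
  have hpi : ∀ u, IsPiSystem (preimage (nearest p X los y u) '' range Ici) := fun u => by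
    have h := (isPiSystem_Ici (α := ℝ≥0∞)).comap (nearest p X los y u)
    exact h
  refine IndepSets.indep (measurable_nearest hnet t).comap_le (measurable_nearest hnet !t).comap_le
    (hpi t) (hpi !t) (hgen t) (hgen !t) ?_
  rw [IndepSets_iff]
  rintro _ _ ⟨_, ⟨a, rfl⟩, rfl⟩ ⟨_, ⟨b, rfl⟩, rfl⟩
  have h1 : nearest p X los y t ⁻¹' Ici a ∩ nearest p X los y (!t) ⁻¹' Ici b =
      {ω | ∀ u, (if u = t then a else b) ≤ nearest p X los y u ω} := by
    ext ω
    cases t <;> simp [and_comm]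
  have h2 : ∀ u c, nearest p X los y u ⁻¹' Ici c = {ω | c ≤ nearest p X los y u ω} :=
    fun _ _ => rfl
  rw [h1, h2, h2, measure_forall_le_nearest hp hnet, measure_le_nearest hp hnet,
    measure_le_nearest hp hnet]
  cases t <;> simp [mul_comm]

/-- The nearest link of type `t`, if there is one, has the density `nearestDensity`. -/
lemma map_nearest_restrict [IsProbabilityMeasure μ] (hp : p.Valid)
    (hnet : IsNetwork p X los g y μ) (t : Bool) :
    ((μ.map (nearest p X los y t)).restrict {∞}ᶜ).map ENNReal.toReal =
      (volume.restrict (Ici p.h)).withDensity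
        fun r => ENNReal.ofReal (nearestDensity p t r) := by
  have hm := measurable_nearest hnet t
  have : IsProbabilityMeasure (μ.map (nearest p X los y t)) :=
    Measure.isProbabilityMeasure_map hm.aemeasurable
  refine Measure.ext_of_Ico _ _ fun a b hab => ?_
  rw [Measure.map_apply ENNReal.measurable_toReal measurableSet_Ico,
    Measure.restrict_apply (ENNReal.measurable_toReal measurableSet_Ico),
    Measure.map_apply hm ((ENNReal.measurable_toReal measurableSet_Ico).inter
      (measurableSet_singleton _).compl),
    withDensity_apply _ measurableSet_Ico, Measure.restrict_restrict measurableSet_Ico]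
  have h1 : nearest p X los y t ⁻¹' (ENNReal.toReal ⁻¹' Ico a b ∩ {∞}ᶜ) =
      {ω | ENNReal.ofReal a ≤ nearest p X los y t ω} \
        {ω | ENNReal.ofReal b ≤ nearest p X los y t ω} := by
    ext ω
    simp only [mem_preimage, mem_inter_iff, mem_Ico, mem_compl_iff, mem_singleton_iff,
      Set.mem_sdiff, mem_ofPred_eq, not_le]
    rcases eq_or_ne (nearest p X los y t ω) ∞ with h | h
    · simp [h]
    · rw [ENNReal.ofReal_le_iff_le_toReal h, ENNReal.lt_ofReal_iff_toReal_lt h]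
      simp [h]
  have h2 : (Ico a b ∩ Ici p.h : Set ℝ) = Ico (max a p.h) (max b p.h) := by
    ext r
    simp only [mem_inter_iff, mem_Ico, mem_Ici, max_le_iff, lt_max_iff]
    grind
  have hsub : {ω | ENNReal.ofReal b ≤ nearest p X los y t ω} ⊆
      {ω | ENNReal.ofReal a ≤ nearest p X los y t ω} :=
    fun ω (h : _ ≤ _) => (ENNReal.ofReal_le_ofReal hab.le).trans h
  rw [h1, measure_sdiff hsub
    (measurableSet_le measurable_const hm).nullMeasurableSet (measure_ne_top _ _),
    measure_ofReal_le_nearest hp hnet, measure_ofReal_le_nearest hp hnet, h2,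
    lintegral_nearestDensity hp t (le_max_right _ _) (max_le_max_right _ hab.le), cumRate_max,
    cumRate_max, ENNReal.ofReal_sub _ (Real.exp_pos _).le]

/-- Averaging over the nearest link of type `t`, with the nearest link of the other type
integrated out. -/
lemma measure_nearest_mem [IsProbabilityMeasure μ] (hp : p.Valid)
    (hnet : IsNetwork p X los g y μ) (t : Bool) {S : Set (ℝ × ℝ≥0∞)} (hS : MeasurableSet S) :
    μ {ω | nearest p X los y t ω ≠ ∞ ∧
        ((nearest p X los y t ω).toReal, nearest p X los y (!t) ω) ∈ S} =
      ∫⁻ r in Ici p.h, ENNReal.ofReal (nearestDensity p t r) *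
        μ {ω | (r, nearest p X los y (!t) ω) ∈ S} := by
  have hm := measurable_nearest hnet
  have : IsProbabilityMeasure (μ.map (nearest p X los y !t)) :=
    Measure.isProbabilityMeasure_map (hm _).aemeasurable
  have hlaw := (indepFun_iff_map_prod_eq_prod_map_map (hm t).aemeasurable
    (hm !t).aemeasurable).1 (indepFun_nearest hp hnet t)
  set S' : Set (ℝ≥0∞ × ℝ≥0∞) := {x | x.1 ≠ ∞ ∧ (x.1.toReal, x.2) ∈ S} with hS'
  have hS'm : MeasurableSet S' := by
    refine MeasurableSet.inter (measurable_fst (measurableSet_singleton ∞).compl) ?_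
    exact ((ENNReal.measurable_toReal.comp measurable_fst).prodMk measurable_snd) hS
  have hFm : Measurable fun r : ℝ => (μ.map (nearest p X los y !t)) (Prod.mk r ⁻¹' S) :=
    measurable_measure_prodMk_left hS
  calc μ {ω | nearest p X los y t ω ≠ ∞ ∧
        ((nearest p X los y t ω).toReal, nearest p X los y (!t) ω) ∈ S}
      = (μ.map fun ω => (nearest p X los y t ω, nearest p X los y (!t) ω)) S' :=
        (Measure.map_apply ((hm t).prodMk (hm !t)) hS'm).symm
    _ = ∫⁻ x, (μ.map (nearest p X los y !t)) (Prod.mk x ⁻¹' S') ∂(μ.map (nearest p X los y t)) := by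
        rw [hlaw, Measure.prod_apply hS'm]
    _ = ∫⁻ x in {∞}ᶜ, (μ.map (nearest p X los y !t)) (Prod.mk x.toReal ⁻¹' S)
          ∂(μ.map (nearest p X los y t)) := by
        rw [← lintegral_indicator (measurableSet_singleton ∞).compl]
        refine lintegral_congr fun x => ?_
        by_cases hx : x = ∞
        · simp [hx, hS', preimage]
        · rw [indicator_of_mem (show x ∈ ({∞}ᶜ : Set ℝ≥0∞) from hx)]
          congr 1
          ext z
          simp [hS', hx]
    _ = ∫⁻ r, (μ.map (nearest p X los y !t)) (Prod.mk r ⁻¹' S)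
          ∂(((μ.map (nearest p X los y t)).restrict {∞}ᶜ).map ENNReal.toReal) :=
        (lintegral_map hFm ENNReal.measurable_toReal).symm
    _ = _ := by
        rw [map_nearest_restrict hp hnet, lintegral_withDensity_eq_lintegral_mul _
          (measurable_nearestDensity hp t).ennreal_ofReal hFm]
        refine lintegral_congr fun r => ?_
        rw [Pi.mul_apply, Measure.map_apply (hm _) (measurable_prodMk_left hS)]
        rfl

lemma measure_nearest_eq_ofReal [IsProbabilityMeasure μ] (hp : p.Valid)
    (hnet : IsNetwork p X los g y μ) (t : Bool) {s : ℝ} (hs : 0 < s) :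
    μ {ω | nearest p X los y t ω = ENNReal.ofReal s} = 0 := by
  have h : ((μ.map (nearest p X los y t)).restrict {∞}ᶜ).map ENNReal.toReal {s} = 0 := by
    rw [map_nearest_restrict hp hnet]
    exact measure_singleton s
  have hm := ENNReal.measurable_toReal (measurableSet_singleton s)
  rw [Measure.map_apply ENNReal.measurable_toReal (measurableSet_singleton s),
    Measure.restrict_apply hm, Measure.map_apply (measurable_nearest hnet t)
      (hm.inter (measurableSet_singleton _).compl)] at h
  refine measure_mono_null (fun ω (hω : _ = _) => ?_) h
  simp [hω, hs.le]

/-- By independence, a tie would make the nearest link of the other type hit a prescribed positive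
length, but its law has no atoms there. -/
lemma ae_not_nearestTie [IsProbabilityMeasure μ] (hp : p.Valid)
    (hnet : IsNetwork p X los g y μ) (t : Bool) :
    ∀ᵐ ω ∂μ, ¬NearestTie p X los y t ω := by
  rw [ae_iff]
  simp only [not_not]
  have hS : MeasurableSet {x : ℝ × ℝ≥0∞ | x.2 = ENNReal.ofReal (eqDist p t x.1)} :=
    measurableSet_eq_fun measurable_snd ((measurable_eqDist t).comp measurable_fst).ennreal_ofReal
  refine (measure_nearest_mem hp hnet t hS).trans ?_
  refine (setLIntegral_congr_fun measurableSet_Ici fun r (hr : p.h ≤ r) => ?_).trans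
    (lintegral_zero)
  have := measure_nearest_eq_ofReal hp hnet (!t) (eqDist_pos hp t (hp.h_pos.trans_le hr))
  simp only [mem_ofPred_eq, this, mul_zero]

/-! ### The law of the serving link -/

/-- Density of the length of the serving link, on the event that it is of type `t`. -/
noncomputable def servingDensity (p : Params) (t : Bool) (r : ℝ) : ℝ :=
  Real.exp (-cumRate p (!t) (eqDist p t r)) * nearestDensity p t r

lemma measurable_servingDensity (hp : p.Valid) (t : Bool) : Measurable (servingDensity p t) := by
  have := (measurable_cumRate hp !t).comp (measurable_eqDist (p := p) t)
  have := measurable_nearestDensity hp t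
  unfold servingDensity
  fun_prop

lemma ae_existsUnique_isStrongest [IsProbabilityMeasure μ] (hp : p.Valid)
    (hnet : IsNetwork p X los g y μ) : ∀ᵐ ω ∂μ, ∃! i, IsStrongest p X los y ω i := by
  filter_upwards [ae_finite_dist3_le hp hnet, ae_dist3_injective hp hnet,
    ae_all_iff.2 (ae_not_nearestTie hp hnet)] with ω h1 h2 h3
  exact existsUnique_isStrongest hp h1 h2 h3

/-- The serving link is of type `t` and of length `r` when the nearest link of type `t` has
length `r` and, independently, no link of the other type is shorter than `eqDist p t r`. -/
theorem measure_servingLink_mem [IsProbabilityMeasure μ] (hp : p.Valid)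
    (hnet : IsNetwork p X los g y μ) (t : Bool) {B : Set ℝ} (hB : MeasurableSet B) :
    μ {ω | (servingLink p X los y ω).1 = t ∧ (servingLink p X los y ω).2 ∈ B} =
      ∫⁻ r in B ∩ Ici p.h, ENNReal.ofReal (servingDensity p t r) := by
  have hS : MeasurableSet
      {x : ℝ × ℝ≥0∞ | x.1 ∈ B ∧ ENNReal.ofReal (eqDist p t x.1) ≤ x.2} :=
    (measurable_fst hB).inter (measurableSet_le
      ((measurable_eqDist t).comp measurable_fst).ennreal_ofReal measurable_snd)
  have hae : {ω | (servingLink p X los y ω).1 = t ∧ (servingLink p X los y ω).2 ∈ B} =ᵐ[μ]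
      {ω | nearest p X los y t ω ≠ ∞ ∧
        ((nearest p X los y t ω).toReal, nearest p X los y (!t) ω) ∈
          {x : ℝ × ℝ≥0∞ | x.1 ∈ B ∧ ENNReal.ofReal (eqDist p t x.1) ≤ x.2}} := by
    rw [eventuallyEq_set]
    filter_upwards [ae_finite_dist3_le hp hnet, ae_all_iff.2 (ae_not_nearestTie hp hnet)]
      with ω h1 h3
    exact serving_mem_iff hp h1 h3 t B
  rw [measure_congr hae, measure_nearest_mem hp hnet t hS,
    ← Measure.restrict_restrict hB, ← lintegral_indicator hB]
  refine setLIntegral_congr_fun measurableSet_Ici fun r (hr : p.h ≤ r) => ?_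
  by_cases hrB : r ∈ B
  · simp only [mem_ofPred_eq, hrB, true_and, indicator_of_mem]
    rw [measure_ofReal_le_nearest hp hnet, servingDensity,
      ENNReal.ofReal_mul (Real.exp_pos _).le, mul_comm]
  · simp [hrB]

end

section

/-! ### Independence of the serving gain from the serving link and the interference -/

section Measurability

variable {p : Params} {Ω : Type*} [MeasurableSpace Ω] {X : ℕ → Ω → Plane} {los : ℕ → Ω → Bool}
  {g : ℕ → Ω → ℝ} {y : Plane}

lemma measurable_zeta_prod : Measurable fun z : Bool × ℝ => zeta p z.1 z.2 :=
  measurable_from_prod_countable_right fun t => measurable_zeta t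

lemma measurable_beta (hX : ∀ i, Measurable (X i)) (hlos : ∀ i, Measurable (los i)) (i : ℕ) :
    Measurable (beta p X los y i) :=
  measurable_zeta_prod.comp ((hlos i).prodMk ((measurable_dist3 y).comp (hX i)))

lemma measurable_serving (hX : ∀ i, Measurable (X i)) (hlos : ∀ i, Measurable (los i)) :
    Measurable (serving p X los y) := by
  have hb := measurable_beta (p := p) (y := y) hX hlos
  have hS : ∀ i, MeasurableSet {ω | IsStrongest p X los y ω i} := fun i => by
    simp only [IsStrongest, ofPred_forall]
    exact MeasurableSet.iInter fun j => measurableSet_le ((hb j).const_mul _) ((hb i).const_mul _)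
  refine measurable_to_countable' fun n => ?_
  -- The second set is the event that no UAV is the strongest, where `serving` is `sInf ∅ = 0`.
  have h : serving p X los y ⁻¹' {n} =
      ({ω | IsStrongest p X los y ω n} ∩ ⋂ m, ⋂ (_ : m < n), {ω | IsStrongest p X los y ω m}ᶜ) ∪
      ({_ω | n = 0} ∩ ⋂ m, {ω | IsStrongest p X los y ω m}ᶜ) := by
    ext ω
    simp only [mem_preimage, mem_singleton_iff, mem_union, mem_inter_iff, mem_ofPred_eq, mem_iInter,
      mem_compl_iff, serving]
    constructor
    · intro hn
      by_cases he : {i | IsStrongest p X los y ω i}.Nonempty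
      · left
        refine ⟨hn ▸ Nat.sInf_mem he, fun m hm => Nat.notMem_of_lt_sInf (hn ▸ hm)⟩
      · rw [not_nonempty_iff_eq_empty] at he
        right
        refine ⟨by rw [← hn, he, Nat.sInf_empty], fun m hm => ?_⟩
        have : m ∈ {i | IsStrongest p X los y ω i} := hm
        simp [he] at this
    · rintro (⟨h1, h2⟩ | ⟨rfl, h2⟩)
      · refine le_antisymm (Nat.sInf_le h1) (not_lt.1 fun hlt => h2 _ hlt ?_)
        exact Nat.sInf_mem (s := {i | IsStrongest p X los y ω i}) ⟨n, h1⟩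
      · exact Nat.sInf_eq_zero.2 (Or.inr (eq_empty_of_forall_notMem h2))
  rw [h]
  exact ((hS n).inter (MeasurableSet.iInter fun m => MeasurableSet.iInter fun _ =>
    (hS m).compl)).union
      ((MeasurableSet.const _).inter (MeasurableSet.iInter fun m => (hS m).compl))

lemma measurable_comp_serving (hX : ∀ i, Measurable (X i)) (hlos : ∀ i, Measurable (los i))
    {β : Type*} [MeasurableSpace β] {f : ℕ → Ω → β} (hf : ∀ i, Measurable (f i)) :
    Measurable fun ω => f (serving p X los y ω) ω :=
  (measurable_from_prod_countable_right (f := fun z : ℕ × Ω => f z.1 z.2) hf).comp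
    ((measurable_serving hX hlos).prodMk measurable_id)

lemma measurable_servingLink (hX : ∀ i, Measurable (X i)) (hlos : ∀ i, Measurable (los i)) :
    Measurable (servingLink p X los y) :=
  measurable_comp_serving (f := fun i ω => (los i ω, dist3 p y (X i ω))) hX hlos fun i =>
    (hlos i).prodMk ((measurable_dist3 y).comp (hX i))

lemma measurable_interference (hX : ∀ i, Measurable (X i)) (hlos : ∀ i, Measurable (los i))
    (hg : ∀ i, Measurable (g i)) : Measurable (interference p X los g y) :=
  Measurable.tsum fun i => Measurable.ite
    ((measurable_serving hX hlos) (measurableSet_eq_fun measurable_const measurable_id))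
    measurable_const
    (((measurable_beta hX hlos i).const_mul _).mul (hg i)).ennreal_ofReal

lemma measurable_sinrValue : Measurable fun v : ℝ × ℝ × ℝ≥0∞ => sinrValue p v.1 v.2.1 v.2.2 := by
  unfold sinrValue
  fun_prop

end Measurability

section Independence

variable {Ω : Type*} [MeasurableSpace Ω] {μ : Measure Ω}

/-- If `A`, `B` are independent and `(A, B)` is independent of `C`, then `A` is independent of
`(B, C)`. -/
lemma indepFun_prodMk_right [IsProbabilityMeasure μ] {α β γ : Type*} [MeasurableSpace α]
    [MeasurableSpace β] [MeasurableSpace γ] {A : Ω → α} {B : Ω → β} {C : Ω → γ}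
    (hA : Measurable A) (hB : Measurable B) (hC : Measurable C) (hAB : IndepFun A B μ)
    (hABC : IndepFun (fun ω => (A ω, B ω)) C μ) : IndepFun A (fun ω => (B ω, C ω)) μ := by
  have := Measure.isProbabilityMeasure_map (μ := μ) hA.aemeasurable
  have := Measure.isProbabilityMeasure_map (μ := μ) hB.aemeasurable
  have := Measure.isProbabilityMeasure_map (μ := μ) hC.aemeasurable
  have hBC : IndepFun B C μ := hABC.comp measurable_snd measurable_id
  rw [indepFun_iff_map_prod_eq_prod_map_map hA.aemeasurable (hB.prodMk hC).aemeasurable,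
    (indepFun_iff_map_prod_eq_prod_map_map hB.aemeasurable hC.aemeasurable).1 hBC,
    ← Measure.prodAssoc_prod,
    ← (indepFun_iff_map_prod_eq_prod_map_map hA.aemeasurable hB.aemeasurable).1 hAB,
    ← (indepFun_iff_map_prod_eq_prod_map_map (hA.prodMk hB).aemeasurable hC.aemeasurable).1 hABC,
    Measure.map_map MeasurableEquiv.prodAssoc.measurable ((hA.prodMk hB).prodMk hC)]
  rfl

/-- In an independent family, each member is independent of the family of the others (which is
encoded by replacing the member by a constant). -/
lemma indepFun_update [IsProbabilityMeasure μ] {α : Type*} [MeasurableSpace α] {g : ℕ → Ω → α}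
    (hg : ∀ i, Measurable (g i)) (hind : iIndepFun g μ) (i : ℕ) (c : α) :
    IndepFun (g i) (fun ω => Function.update (fun j => g j ω) i c) μ := by
  have h := indep_iSup_of_disjoint (fun j => (hg j).comap_le) hind
    (disjoint_compl_right (a := ({i} : Set ℕ)))
  refine indep_of_indep_of_le_left (indep_of_indep_of_le_right h ?_) ?_
  · rw [← measurable_iff_comap_le]
    refine @measurable_pi_lambda _ _ _ (_) _ _ fun j => ?_
    rcases eq_or_ne j i with rfl | hj
    · simp only [Function.update_self]
      exact @measurable_const _ _ _ (_) _
    · simp only [Function.update_of_ne hj]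
      rw [measurable_iff_comap_le]
      exact le_iSup₂_of_le j hj le_rfl
  · exact le_iSup₂_of_le i rfl le_rfl

end Independence

variable {p : Params} {Ω : Type*} [MeasurableSpace Ω] {X : ℕ → Ω → Plane} {los : ℕ → Ω → Bool}
  {g : ℕ → Ω → ℝ} {y : Plane} {μ : Measure Ω}

/-- The gain of link `i` is independent of the other gains, the positions and the link types. -/
lemma indepFun_gain [IsProbabilityMeasure μ] (hnet : IsNetwork p X los g y μ) (i : ℕ) :
    IndepFun (g i) (fun ω => ((Function.update (fun j => g j ω) i 0 : ℕ → ℝ),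
      fun j => (X j ω, los j ω))) μ := by
  have hup : Measurable fun v : ℕ → ℝ => Function.update v i 0 :=
    measurable_pi_lambda _ fun j => by
      rcases eq_or_ne j i with rfl | hj
      · simp
      · simp only [Function.update_of_ne hj]
        exact measurable_pi_apply j
  have hg := hnet.gain_measurable
  refine indepFun_prodMk_right (hg i) (hup.comp (measurable_pi_lambda _ hg))
    (measurable_pi_lambda _ fun j => (hnet.poisson.measurable j).prodMk (hnet.los_measurable j))
    (indepFun_update hg hnet.gain_iIndep i 0) ?_
  exact hnet.gain_indep.comp ((measurable_pi_apply i).prodMk hup) measurable_id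

lemma measure_eq_tsum_serving (hnet : IsNetwork p X los g y μ) {S : Set Ω} (hS : MeasurableSet S) :
    μ S = ∑' i, μ (S ∩ {ω | serving p X los y ω = i}) := by
  have hs : ∀ i, MeasurableSet {ω | serving p X los y ω = i} := fun i =>
    measurable_serving hnet.poisson.measurable hnet.los_measurable (measurableSet_singleton i)
  rw [← measure_iUnion _ fun i => hS.inter (hs i), ← inter_iUnion]
  · congr 1
    ext ω
    simp
  · intro i j hij
    exact Set.disjoint_left.2 fun ω h h' => hij (h.2.symm.trans h'.2)

/-- The serving gain keeps the exponential law, and is independent of the serving link and of the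
interference: the choice of the serving UAV `i` depends on positions and link types only, and given
this choice the interference involves the gains `g j` with `j ≠ i` only. -/
lemma measure_serving_gain_inter [IsProbabilityMeasure μ] (hnet : IsNetwork p X los g y μ)
    {C : Set ℝ} (hC : MeasurableSet C) {D : Set ((Bool × ℝ) × ℝ≥0∞)} (hD : MeasurableSet D) :
    μ {ω | g (serving p X los y ω) ω ∈ C ∧
        (servingLink p X los y ω, interference p X los g y ω) ∈ D} =
      expMeasure 1 C *
        μ {ω | (servingLink p X los y ω, interference p X los g y ω) ∈ D} := by
  have hX := hnet.poisson.measurable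
  have hlos := hnet.los_measurable
  have hg := hnet.gain_measurable
  have hSI : Measurable fun ω => (servingLink p X los y ω, interference p X los g y ω) :=
    (measurable_servingLink hX hlos).prodMk (measurable_interference hX hlos hg)
  have hgs : Measurable fun ω => g (serving p X los y ω) ω := measurable_comp_serving hX hlos hg
  have hm : MeasurableSet {ω | g (serving p X los y ω) ω ∈ C ∧
      (servingLink p X los y ω, interference p X los g y ω) ∈ D} := (hgs hC).inter (hSI hD)
  have hm' : MeasurableSet {ω | (servingLink p X los y ω, interference p X los g y ω) ∈ D} :=
    hSI hD
  rw [measure_eq_tsum_serving hnet hm, measure_eq_tsum_serving hnet hm', ← ENNReal.tsum_mul_left]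
  refine tsum_congr fun i => ?_
  -- The network as seen from the space of configurations of gains and links. It is evaluated at
  -- `V ω`, where the gain of link `i` is replaced by `0`.
  let Y := (ℕ → ℝ) × (ℕ → Plane × Bool)
  let X' : ℕ → Y → Plane := fun j v => (v.2 j).1
  let los' : ℕ → Y → Bool := fun j v => (v.2 j).2
  let g' : ℕ → Y → ℝ := fun j v => v.1 j
  have hX' : ∀ j, Measurable (X' j) := fun j =>
    measurable_fst.comp ((measurable_pi_apply j).comp measurable_snd)
  have hlos' : ∀ j, Measurable (los' j) := fun j =>
    measurable_snd.comp ((measurable_pi_apply j).comp measurable_snd)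
  have hg' : ∀ j, Measurable (g' j) := fun j => (measurable_pi_apply j).comp measurable_fst
  set D' : Set Y := {v | (servingLink p X' los' y v, interference p X' los' g' y v) ∈ D} ∩
    {v | serving p X' los' y v = i} with hD'
  have hD'm : MeasurableSet D' :=
    (((measurable_servingLink hX' hlos').prodMk (measurable_interference hX' hlos' hg')) hD).inter
      (measurable_serving hX' hlos' (measurableSet_singleton i))
  set V : Ω → Y := fun ω => ((Function.update (fun j => g j ω) i 0 : ℕ → ℝ),
    fun j => (X j ω, los j ω)) with hV
  have hpre : {ω | (servingLink p X los y ω, interference p X los g y ω) ∈ D} ∩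
      {ω | serving p X los y ω = i} = V ⁻¹' D' := by
    ext ω
    have h1 : serving p X' los' y (V ω) = serving p X los y ω := rfl
    have h2 : servingLink p X' los' y (V ω) = servingLink p X los y ω := rfl
    have h3 : serving p X los y ω = i →
        interference p X' los' g' y (V ω) = interference p X los g y ω := fun hi => by
      refine tsum_congr fun j => ?_
      rw [h1, hi]
      split_ifs with hj
      · rfl
      · have : g' j (V ω) = g j ω := Function.update_of_ne hj (0 : ℝ) fun j => g j ω
        rw [this]
        rfl
    simp only [hD', mem_inter_iff, mem_ofPred_eq, mem_preimage, h1, h2]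
    refine and_congr_left fun hi => ?_
    rw [h3 hi]
  have hpre2 : {ω | g (serving p X los y ω) ω ∈ C ∧
        (servingLink p X los y ω, interference p X los g y ω) ∈ D} ∩
      {ω | serving p X los y ω = i} = g i ⁻¹' C ∩ V ⁻¹' D' := by
    rw [← hpre]
    ext ω
    simp only [mem_inter_iff, mem_ofPred_eq, mem_preimage]
    constructor
    · rintro ⟨⟨h1, h2⟩, rfl⟩
      exact ⟨h1, h2, rfl⟩
    · rintro ⟨h1, h2, rfl⟩
      exact ⟨⟨h1, h2⟩, rfl⟩
  refine (congrArg μ hpre2).trans ?_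
  rw [(indepFun_gain hnet i).measure_inter_preimage_eq_mul _ _ hC hD'm, ← hnet.gain_law i,
    Measure.map_apply (hg i) hC]
  exact congrArg _ (congrArg μ hpre.symm)

lemma map_serving_gain [IsProbabilityMeasure μ] (hnet : IsNetwork p X los g y μ) :
    μ.map (fun ω => (g (serving p X los y ω) ω,
        (servingLink p X los y ω, interference p X los g y ω))) =
      (expMeasure 1).prod
        (μ.map fun ω => (servingLink p X los y ω, interference p X los g y ω)) := by
  have hX := hnet.poisson.measurable
  have hlos := hnet.los_measurable
  have hg := hnet.gain_measurable
  have hSI : Measurable fun ω => (servingLink p X los y ω, interference p X los g y ω) :=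
    (measurable_servingLink hX hlos).prodMk (measurable_interference hX hlos hg)
  have hgs : Measurable fun ω => g (serving p X los y ω) ω := measurable_comp_serving hX hlos hg
  have := isProbabilityMeasure_expMeasure one_pos
  symm
  refine Measure.prod_eq fun C D hC hD => ?_
  rw [Measure.map_apply (hgs.prodMk hSI) (hC.prod hD), Measure.map_apply hSI hD]
  exact measure_serving_gain_inter hnet hC hD

/-! ### The conditional coverage probability -/

/-- Given the serving link, the serving gain is exponential and independent of the
interference. -/
lemma condDistrib_gain_interference [IsProbabilityMeasure μ] (hnet : IsNetwork p X los g y μ) :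
    ∀ᵐ z ∂(μ.map (servingLink p X los y)),
      condDistrib (fun ω => (g (serving p X los y ω) ω, interference p X los g y ω))
        (servingLink p X los y) μ z =
      (expMeasure 1).prod
        (condDistrib (interference p X los g y) (servingLink p X los y) μ z) := by
  have hX := hnet.poisson.measurable
  have hlos := hnet.los_measurable
  have hg := hnet.gain_measurable
  have hS := measurable_servingLink (p := p) (y := y) hX hlos
  have hI := measurable_interference (p := p) (y := y) hX hlos hg
  have hgs : Measurable fun ω => g (serving p X los y ω) ω := measurable_comp_serving hX hlos hg
  have := isProbabilityMeasure_expMeasure one_pos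
  set κ := condDistrib (interference p X los g y) (servingLink p X los y) μ with hκ
  have key := condDistrib_ae_eq_of_measure_eq_compProd (μ := μ) (servingLink p X los y)
    (hgs.prodMk hI).aemeasurable (κ := (Kernel.const (Bool × ℝ) (expMeasure 1)) ×ₖ κ) ?_
  · filter_upwards [key] with z hz
    rw [hz, Kernel.prod_apply, Kernel.const_apply]
  · have hφ : Measurable fun v : ℝ × (Bool × ℝ) × ℝ≥0∞ => (v.2.1, (v.1, v.2.2)) := by fun_prop
    have h1 : μ.map (fun ω => (servingLink p X los y ω,
        (g (serving p X los y ω) ω, interference p X los g y ω))) =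
        (((expMeasure 1).prod (μ.map (servingLink p X los y) ⊗ₘ κ))).map
          fun v : ℝ × (Bool × ℝ) × ℝ≥0∞ => (v.2.1, (v.1, v.2.2)) := by
      rw [hκ, compProd_map_condDistrib hI.aemeasurable, ← map_serving_gain hnet,
        Measure.map_map hφ (hgs.prodMk (hS.prodMk hI))]
      rfl
    rw [h1]
    refine Measure.ext fun S hSm => ?_
    rw [Measure.map_apply hφ hSm, Measure.prod_apply_symm (hφ hSm),
      Measure.lintegral_compProd (measurable_measure_prodMk_right (hφ hSm)),
      Measure.compProd_apply hSm]
    refine lintegral_congr fun z => ?_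
    rw [Kernel.prod_apply, Kernel.const_apply,
      Measure.prod_apply_symm (measurable_prodMk_left hSm)]
    rfl

lemma expMeasure_Ioi {a : ℝ} (ha : 0 ≤ a) :
    expMeasure 1 (Ioi a) = ENNReal.ofReal (Real.exp (-a)) := by
  have := isProbabilityMeasure_expMeasure one_pos
  have h := cdf_expMeasure_eq one_pos a
  rw [cdf_eq_real, if_pos ha, one_mul] at h
  rw [← compl_Iic, prob_compl_eq_one_sub measurableSet_Iic, ← ofReal_measureReal, h,
    ← ENNReal.ofReal_one, ← ENNReal.ofReal_sub _ (by simp [ha])]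
  congr 1
  ring

/-- The tail of the exponential gain turns the event that the SINR exceeds `γ` into a product of a
noise and an interference factor. If `x = ∞` both sides vanish; if `x` and the noise power vanish,
the SINR is `∞` for every positive gain. -/
lemma expMeasure_lt_sinrValue (hp : p.Valid) {γ z : ℝ} (hγ : 0 < γ) (hz : 0 < z) (x : ℝ≥0∞) :
    expMeasure 1 {c | ENNReal.ofReal γ < sinrValue p z c x} =
      ENNReal.ofReal (Real.exp (-(γ * p.N0 / (p.P * z)))) *
        expNeg (ENNReal.ofReal (γ / (p.P * z)) * x) := by
  have hPz : 0 < p.P * z := mul_pos hp.P_pos hz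
  have hN0 := hp.N0_nonneg
  induction x with
  | top =>
    rw [ENNReal.mul_top (ENNReal.ofReal_pos.2 (by positivity)).ne']
    simp [sinrValue, expNeg]
  | coe x =>
    have hx := x.coe_nonneg
    have h1 : {c | ENNReal.ofReal γ < sinrValue p z c x} = Ioi (γ * (x + p.N0) / (p.P * z)) := by
      ext c
      rw [mem_ofPred_eq, mem_Ioi, sinrValue, ← ENNReal.ofReal_coe_nnreal,
        ← ENNReal.ofReal_add hx hN0, ENNReal.lt_div_iff_mul_lt (Or.inr ENNReal.ofReal_ne_top)
          (Or.inl ENNReal.ofReal_ne_top), ← ENNReal.ofReal_mul hγ.le,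
        ENNReal.ofReal_lt_ofReal_iff', div_lt_iff₀ hPz, mul_comm c]
      have : 0 ≤ γ * (x + p.N0) := by positivity
      exact ⟨fun h => h.1, fun h => ⟨h, this.trans_lt h⟩⟩
    rw [h1, expMeasure_Ioi (by positivity), ← ENNReal.ofReal_coe_nnreal,
      ← ENNReal.ofReal_mul (by positivity), expNeg_ofReal (by positivity),
      ← ENNReal.ofReal_mul (Real.exp_pos _).le, ← Real.exp_add]
    congr 2
    field_simp
    ring

lemma ae_condCoverage_eq_noiseLaplace [IsProbabilityMeasure μ] (hp : p.Valid)
    (hnet : IsNetwork p X los g y μ) {γ : ℝ} (hγ : 0 < γ) :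
    ∀ᵐ z ∂(μ.map (servingLink p X los y)), 0 < z.2 →
      condCoverage p X los g y μ γ z.1 z.2 = noiseLaplace p X los g y μ γ z.1 z.2 := by
  have := isProbabilityMeasure_expMeasure one_pos
  filter_upwards [condDistrib_gain_interference hnet] with z hz hpos
  have hm : MeasurableSet
      {x : ℝ × ℝ≥0∞ | ENNReal.ofReal γ < sinrValue p (zeta p z.1 z.2) x.1 x.2} :=
    measurableSet_lt measurable_const (measurable_sinrValue.comp measurable_prodMk_left)
  rw [condCoverage, show (z.1, z.2) = z from rfl, hz, Measure.prod_apply_symm hm, noiseLaplace,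
    laplaceI]
  refine (lintegral_congr fun x =>
    expMeasure_lt_sinrValue hp hγ (zeta_pos hp z.1 hpos) x).trans ?_
  exact lintegral_const_mul _ (continuous_expNeg.measurable.comp (measurable_id.const_mul _))

/-! ### The coverage probability -/

lemma map_servingLink [IsProbabilityMeasure μ] (hp : p.Valid) (hnet : IsNetwork p X los g y μ) :
    μ.map (servingLink p X los y) =
      ∑ t, ((volume.restrict (Ici p.h)).withDensity
        fun r => ENNReal.ofReal (servingDensity p t r)).map (Prod.mk t) := by
  have hS := measurable_servingLink (p := p) (y := y) hnet.poisson.measurable hnet.los_measurable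
  refine Measure.ext fun S hSm => ?_
  have hSt : ∀ t : Bool, MeasurableSet (Prod.mk t ⁻¹' S : Set ℝ) := fun t =>
    measurable_prodMk_left hSm
  have h1 : servingLink p X los y ⁻¹' S =
      {ω | (servingLink p X los y ω).1 = true ∧
        (servingLink p X los y ω).2 ∈ Prod.mk true ⁻¹' S} ∪
      {ω | (servingLink p X los y ω).1 = false ∧
        (servingLink p X los y ω).2 ∈ Prod.mk false ⁻¹' S} := by
    ext ω
    rcases h : servingLink p X los y ω with ⟨t, r⟩
    cases t <;> simp [h]
  rw [Measure.map_apply hS hSm, h1, measure_union, Fintype.sum_bool, Measure.add_apply,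
    measure_servingLink_mem hp hnet true (hSt _), measure_servingLink_mem hp hnet false (hSt _)]
  · congr 1 <;>
      rw [Measure.map_apply measurable_prodMk_left hSm, withDensity_apply _ (hSt _),
        Measure.restrict_restrict (hSt _)]
  · refine Set.disjoint_left.2 fun ω h h' => ?_
    simpa using h.1.symm.trans h'.1
  · exact (hS.fst (measurableSet_singleton false)).inter (hS.snd (hSt _))

lemma lintegral_map_servingLink [IsProbabilityMeasure μ] (hp : p.Valid)
    (hnet : IsNetwork p X los g y μ) {F : Bool × ℝ → ℝ≥0∞} (hF : Measurable F) :
    ∫⁻ z, F z ∂(μ.map (servingLink p X los y)) =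
      ∑ t, ∫⁻ r in Ici p.h, F (t, r) * ENNReal.ofReal (servingDensity p t r) := by
  rw [map_servingLink hp hnet, lintegral_finsetSum_measure]
  refine Finset.sum_congr rfl fun t _ => ?_
  have hFt : Measurable fun r => F (t, r) := hF.comp measurable_prodMk_left
  rw [lintegral_map hF measurable_prodMk_left, lintegral_withDensity_eq_lintegral_mul _
    (measurable_servingDensity hp t).ennreal_ofReal hFt]
  exact lintegral_congr fun r => mul_comm _ _

lemma coverage_eq_sum_condCoverage [IsProbabilityMeasure μ] (hp : p.Valid)
    (hnet : IsNetwork p X los g y μ) (γ : ℝ) :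
    coverage p X los g y μ γ =
      ∑ t, ∫⁻ r in Ici p.h,
        condCoverage p X los g y μ γ t r * ENNReal.ofReal (servingDensity p t r) := by
  have hX := hnet.poisson.measurable
  have hlos := hnet.los_measurable
  have hg := hnet.gain_measurable
  have hS := measurable_servingLink (p := p) (y := y) hX hlos
  have hI := measurable_interference (p := p) (y := y) hX hlos hg
  have hgs : Measurable fun ω => g (serving p X los y ω) ω := measurable_comp_serving hX hlos hg
  have hm : MeasurableSet {v : (Bool × ℝ) × ℝ × ℝ≥0∞ |
      ENNReal.ofReal γ < sinrValue p (zeta p v.1.1 v.1.2) v.2.1 v.2.2} :=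
    measurableSet_lt measurable_const (measurable_sinrValue.comp
      ((measurable_zeta_prod.comp measurable_fst).prodMk measurable_snd))
  have h1 := compProd_map_condDistrib (μ := μ) (mβ := inferInstance) (X := servingLink p X los y)
    (hgs.prodMk hI).aemeasurable
  have h2 : coverage p X los g y μ γ = μ.map (fun ω => (servingLink p X los y ω,
      (g (serving p X los y ω) ω, interference p X los g y ω))) {v : (Bool × ℝ) × ℝ × ℝ≥0∞ |
        ENNReal.ofReal γ < sinrValue p (zeta p v.1.1 v.1.2) v.2.1 v.2.2} := by
    rw [Measure.map_apply (hS.prodMk (hgs.prodMk hI)) hm]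
    rfl
  rw [h2, ← h1, Measure.compProd_apply hm,
    lintegral_map_servingLink hp hnet (Kernel.measurable_kernel_prodMk_left hm)]
  rfl

/-- Wherever the serving density is positive, the conditional coverage probability is the product
of the noise factor and the Laplace transform of the interference. -/
lemma ae_condCoverage_eq [IsProbabilityMeasure μ] (hp : p.Valid)
    (hnet : IsNetwork p X los g y μ) {γ : ℝ} (hγ : 0 < γ) (t : Bool) :
    ∀ᵐ r ∂(volume.restrict (Ici p.h)), servingDensity p t r ≠ 0 →
      condCoverage p X los g y μ γ t r = noiseLaplace p X los g y μ γ t r := by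
  have h := ae_condCoverage_eq_noiseLaplace hp hnet hγ
  rw [map_servingLink hp hnet, Fintype.sum_bool, ae_add_measure_iff] at h
  have h' : ∀ᵐ z ∂(((volume.restrict (Ici p.h)).withDensity
      fun r => ENNReal.ofReal (servingDensity p t r)).map (Prod.mk t)), 0 < z.2 →
      condCoverage p X los g y μ γ z.1 z.2 = noiseLaplace p X los g y μ γ z.1 z.2 := by
    cases t
    exacts [h.2, h.1]
  have h2 := ae_of_ae_map (measurable_prodMk_left (x := t)).aemeasurable h'
  rw [ae_withDensity_iff (measurable_servingDensity hp t).ennreal_ofReal] at h2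
  filter_upwards [h2, ae_restrict_mem measurableSet_Ici] with r hr (hrh : p.h ≤ r) hne
  have hnn : 0 ≤ servingDensity p t r :=
    mul_nonneg (Real.exp_pos _).le (nearestDensity_nonneg hp t hrh)
  exact hr (ENNReal.ofReal_pos.2 (lt_of_le_of_ne hnn hne.symm)).ne' (hp.h_pos.trans_le hrh)

lemma servingDensity_ne_zero (hp : p.Valid) {t : Bool} {r : ℝ} (hr : p.h ≤ r)
    (h : 0 < linkProb p t r) : servingDensity p t r ≠ 0 := by
  have h1 := hp.h_pos.trans_le hr
  have h2 := hp.lam_pos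
  have h3 : 0 < rate p t r := mul_pos h (by positivity)
  exact (mul_pos (Real.exp_pos _) (mul_pos (Real.exp_pos _) h3)).ne'

lemma coverage_eq_sum_noiseLaplace [IsProbabilityMeasure μ] (hp : p.Valid)
    (hnet : IsNetwork p X los g y μ) {γ : ℝ} (hγ : 0 < γ) :
    coverage p X los g y μ γ =
      ∑ t, ∫⁻ r in Ici p.h,
        noiseLaplace p X los g y μ γ t r * ENNReal.ofReal (servingDensity p t r) := by
  rw [coverage_eq_sum_condCoverage hp hnet]
  refine Finset.sum_congr rfl fun t _ => lintegral_congr_ae ?_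
  filter_upwards [ae_condCoverage_eq hp hnet hγ t] with r hr
  by_cases h : servingDensity p t r = 0
  · simp [h]
  · rw [hr h]

lemma servingDensity_true (hp : p.Valid) {r₁ : ℝ → ℝ} {r : ℝ} (hr : p.h ≤ r)
    (hr₁ : 0 < r₁ r ∧ zetaNL p (r₁ r) = zetaL p r) : servingDensity p true r = fL p r₁ r := by
  have h := eq_eqDist hp true (hp.h_pos.trans_le hr) hr₁.1 hr₁.2
  simp only [servingDensity, nearestDensity, fL, cumRate, rate, linkProb, ← h, Bool.not_true,
    Bool.false_eq_true, if_true, if_false]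
  ring

lemma servingDensity_false (hp : p.Valid) {r₂ : ℝ → ℝ} {r : ℝ} (hr : p.h ≤ r)
    (hr₂ : 0 < r₂ r ∧ zetaL p (r₂ r) = zetaNL p r) : servingDensity p false r = fNL p r₂ r := by
  have h := eq_eqDist hp false (hp.h_pos.trans_le hr) hr₂.1 hr₂.2
  simp only [servingDensity, nearestDensity, fNL, cumRate, rate, linkProb, ← h, Bool.not_false,
    Bool.false_eq_true, if_true, if_false]
  ring

end

end UAV

theorem theorem1 {Ω : Type*} [MeasurableSpace Ω] (μ : Measure Ω) [IsProbabilityMeasure μ]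
    (p : UAV.Params) (hlam : 0 < p.lam) (hh : 0 < p.h) (hP : 0 < p.P) (hN0 : 0 ≤ p.N0)
    (hAL : 0 < p.AL) (hANL : 0 < p.ANL) (haL : 0 < p.aL) (haNL : 0 < p.aNL)
    (hprL : Measurable p.prL) (hprL01 : ∀ r, p.h ≤ r → p.prL r ∈ Icc (0 : ℝ) 1)
    (r₁ r₂ : ℝ → ℝ)
    (hr₁ : ∀ r, p.h ≤ r → 0 < r₁ r ∧ UAV.zetaNL p (r₁ r) = UAV.zetaL p r)
    (hr₂ : ∀ r, p.h ≤ r → 0 < r₂ r ∧ UAV.zetaL p (r₂ r) = UAV.zetaNL p r)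
    (X : ℕ → Ω → UAV.Plane) (los : ℕ → Ω → Bool) (g : ℕ → Ω → ℝ) (y : UAV.Plane)
    (hnet : UAV.IsNetwork p X los g y μ) (γ : ℝ) (hγ : 0 < γ) :
    -- the serving UAV is almost surely well defined
    (∀ᵐ ω ∂μ, ∃! i, UAV.IsStrongest p X los y ω i) ∧
    -- `fL` and `fNL` are the densities of the serving distance, jointly with the link type
    (∀ B : Set ℝ, MeasurableSet B →
      μ {ω | (UAV.servingLink p X los y ω).1 = true ∧ (UAV.servingLink p X los y ω).2 ∈ B} =
        ∫⁻ r in B ∩ Ici p.h, ENNReal.ofReal (UAV.fL p r₁ r)) ∧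
    (∀ B : Set ℝ, MeasurableSet B →
      μ {ω | (UAV.servingLink p X los y ω).1 = false ∧ (UAV.servingLink p X los y ω).2 ∈ B} =
        ∫⁻ r in B ∩ Ici p.h, ENNReal.ofReal (UAV.fNL p r₂ r)) ∧
    -- the coverage probability is `T^L + T^NL`
    UAV.coverage p X los g y μ γ =
      (∫⁻ r in Ici p.h,
        UAV.condCoverage p X los g y μ γ true r * ENNReal.ofReal (UAV.fL p r₁ r)) +
      (∫⁻ r in Ici p.h,
        UAV.condCoverage p X los g y μ γ false r * ENNReal.ofReal (UAV.fNL p r₂ r)) ∧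
    -- the conditional coverage probabilities, at almost every distance where they are defined
    (∀ᵐ r ∂(volume.restrict (Ici p.h)), 0 < p.prL r →
      UAV.condCoverage p X los g y μ γ true r = UAV.noiseLaplace p X los g y μ γ true r) ∧
    (∀ᵐ r ∂(volume.restrict (Ici p.h)), p.prL r < 1 →
      UAV.condCoverage p X los g y μ γ false r = UAV.noiseLaplace p X los g y μ γ false r) ∧
    -- the resulting expression of the coverage probability
    UAV.coverage p X los g y μ γ =
      (∫⁻ r in Ici p.h,
        UAV.noiseLaplace p X los g y μ γ true r * ENNReal.ofReal (UAV.fL p r₁ r)) +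
      (∫⁻ r in Ici p.h,
        UAV.noiseLaplace p X los g y μ γ false r * ENNReal.ofReal (UAV.fNL p r₂ r)) := by
  have hp : UAV.Params.Valid p := ⟨hlam, hh, hP, hN0, hAL, hANL, haL, haNL, hprL, hprL01⟩
  have hL : ∀ r ∈ Ici p.h, UAV.servingDensity p true r = UAV.fL p r₁ r := fun r hr =>
    UAV.servingDensity_true hp hr (hr₁ r hr)
  have hNL : ∀ r ∈ Ici p.h, UAV.servingDensity p false r = UAV.fNL p r₂ r := fun r hr =>
    UAV.servingDensity_false hp hr (hr₂ r hr)
  have hsum : ∀ F : Bool → ℝ → ℝ≥0∞,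
      ∑ t, ∫⁻ r in Ici p.h, F t r * ENNReal.ofReal (UAV.servingDensity p t r) =
        (∫⁻ r in Ici p.h, F true r * ENNReal.ofReal (UAV.fL p r₁ r)) +
          ∫⁻ r in Ici p.h, F false r * ENNReal.ofReal (UAV.fNL p r₂ r) := fun F => by
    rw [Fintype.sum_bool]
    congr 1
    · exact setLIntegral_congr_fun measurableSet_Ici fun r hr => by simp only [hL r hr]
    · exact setLIntegral_congr_fun measurableSet_Ici fun r hr => by simp only [hNL r hr]
  refine ⟨UAV.ae_existsUnique_isStrongest hp hnet, fun B hB => ?_, fun B hB => ?_, ?_, ?_, ?_, ?_⟩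
  · rw [UAV.measure_servingLink_mem hp hnet true hB]
    exact setLIntegral_congr_fun (hB.inter measurableSet_Ici) fun r hr => by
      simp only [hL r hr.2]
  · rw [UAV.measure_servingLink_mem hp hnet false hB]
    exact setLIntegral_congr_fun (hB.inter measurableSet_Ici) fun r hr => by
      simp only [hNL r hr.2]
  · rw [UAV.coverage_eq_sum_condCoverage hp hnet, hsum]
  · filter_upwards [UAV.ae_condCoverage_eq hp hnet hγ true, ae_restrict_mem measurableSet_Ici]
      with r hr hrh hpr
    exact hr (UAV.servingDensity_ne_zero hp hrh (by simpa [UAV.linkProb] using hpr))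
  · filter_upwards [UAV.ae_condCoverage_eq hp hnet hγ false, ae_restrict_mem measurableSet_Ici]
      with r hr hrh hpr
    exact hr (UAV.servingDensity_ne_zero hp hrh (by simpa [UAV.linkProb] using hpr))
  · rw [UAV.coverage_eq_sum_noiseLaplace hp hnet hγ, hsum]
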